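/- Let $d\ge 0$ and $K>0$. There is a constant $C<\infty$, depending only on $d$ and $K$, with the following property. Let $\alpha=(\alpha_x)_{x\in\mathbb Z^d}$ be any field with $-K\le\alpha_x\le K$ for all $x$, put $p_x=e^{\alpha_x}/(1+e^{\alpha_x})$, let $\Lambda_L=\{x\in\mathbb Z^d : x_i-a_i\in\{0,\dots,L-1\},\ i=1,\dots,d\}$, with $a\in\mathbb Z^d$, be any box of side length $L$, let $0\le N\le L^d$, and let $f:\{0,1\}^{\Lambda_L}\to\mathbb R$ be any function. Let $\mu_{\Lambda_L}(\eta)=\prod_{x\in\Lambda_L}p_x^{\eta_x}(1-p_x)^{1-\eta_x}$ be the inhomogeneous Bernoulli measure on $\{0,1\}^{\Lambda_L}$, and let $\mu_{\Lambda_L,N}=\mu_{\Lambda_L}(\,\cdot\mid\sum_{x\in\Lambda_L}\eta_x=N)$. Then $$\mathrm{Var}_{\mu_{\Lambda_L,N}}(f)=E_{\mu_{\Lambda_L,N}}\big[(f-E_{\mu_{\Lambda_L,N}}[f])^2\big]\le C\,L^2\,D_{\mathrm{Kaw}}(\Lambda_L,N;f),$$ where $$D_{\mathrm{Kaw}}(\Lambda_L,N;f)=E_{\mu_{\Lambda_L,N}}\Big[\sum_{x,y\in\Lambda_L,\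 x\sim y}\big(f(T_{x,y}\eta)-f(\eta)\big)^2\Big]$$ is the Kawasaki Dirichlet form; here the sum is over ordered pairs, $x\sim y$ means that $x$ and $y$ are nearest neighbours in $\mathbb Z^d$ ($\sum_i|x_i-y_i|=1$), and $T_{x,y}\eta$ is the configuration obtained from $\eta$ by exchanging the values $\eta_x$ and $\eta_y$. -/

import Mathlib

namespace InhomBernoulli

open MeasureTheory ProbabilityTheory

/-- Particle configurations `{0,1}^Λ` on a finite set of sites `Λ ⊂ ℤ^d`:
`η x = 1` if there is a particle at `x`, and `η x = 0` otherwise. -/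
abbrev Config {d : ℕ} (Λ : Finset (Fin d → ℤ)) : Type := Λ → Fin 2

/-- The number of particles `∑_{x ∈ Λ} η_x`. -/
def particleNumber {d : ℕ} {Λ : Finset (Fin d → ℤ)} (η : Config Λ) : ℕ :=
  ∑ x : Λ, (η x : ℕ)

/-- The density `p_x = e^{α_x} / (1 + e^{α_x})` at the site `x`. -/
noncomputable def density {d : ℕ} (α : (Fin d → ℤ) → ℝ) (x : Fin d → ℤ) : ℝ :=
  Real.exp (α x) / (1 + Real.exp (α x))

/-- The weight `∏_{x ∈ Λ} p_x^{η_x} (1 - p_x)^{1 - η_x}` of a configuration. -/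
noncomputable def weight {d : ℕ} (α : (Fin d → ℤ) → ℝ) (Λ : Finset (Fin d → ℤ))
    (η : Config Λ) : ℝ :=
  ∏ x : Λ, density α x ^ (η x : ℕ) * (1 - density α x) ^ (1 - (η x : ℕ))

/-- The inhomogeneous Bernoulli measure `μ_Λ` on `{0,1}^Λ` with field `α`. -/
noncomputable def inhomBernoulliMeasure {d : ℕ} (α : (Fin d → ℤ) → ℝ) (Λ : Finset (Fin d → ℤ)) :
    Measure (Config Λ) :=
  ∑ η : Config Λ, ENNReal.ofReal (weight α Λ η) • Measure.dirac η

/-- The canonical measure `μ_{Λ,N} = μ_Λ( · | ∑_x η_x = N)`. -/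
noncomputable def canonicalMeasure {d : ℕ} (α : (Fin d → ℤ) → ℝ) (Λ : Finset (Fin d → ℤ))
    (N : ℕ) : Measure (Config Λ) :=
  cond (inhomBernoulliMeasure α Λ) {η | particleNumber η = N}

/-- The nearest neighbour relation `x ∼ y` on `ℤ^d`. -/
def Neighbour {d : ℕ} (x y : Fin d → ℤ) : Prop := ∑ i, |x i - y i| = 1

instance {d : ℕ} (x y : Fin d → ℤ) : Decidable (Neighbour x y) :=
  inferInstanceAs (Decidable (∑ i, |x i - y i| = 1))

/-- `T_{x,y} η`: the configuration `η` with the values at `x` and `y` exchanged. -/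
def exchange {d : ℕ} {Λ : Finset (Fin d → ℤ)} (x y : Λ) (η : Config Λ) : Config Λ :=
  fun z => if z = x then η y else if z = y then η x else η z

/-- The Kawasaki Dirichlet form
`D_Kaw(Λ, N; f) = E_{μ_{Λ,N}} [ ∑_{x ∼ y; x, y ∈ Λ} (f (T_{x,y} η) - f η)² ]`,
the sum being over ordered pairs. -/
noncomputable def kawasakiForm {d : ℕ} (α : (Fin d → ℤ) → ℝ) (Λ : Finset (Fin d → ℤ)) (N : ℕ)
    (f : Config Λ → ℝ) : ℝ :=
  ∫ η, (∑ x : Λ, ∑ y : Λ,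
    if Neighbour (x : Fin d → ℤ) y then (f (exchange x y η) - f η) ^ 2 else 0)
    ∂(canonicalMeasure α Λ N)

/-- The box `{x ∈ ℤ^d : x_i - a_i ∈ {0, …, L - 1} for all i}` of side length `L`. -/
noncomputable def box {d : ℕ} (L : ℕ) (a : Fin d → ℤ) : Finset (Fin d → ℤ) :=
  Fintype.piFinset fun i => Finset.Ico (a i) (a i + L)

end InhomBernoulli

/-! The factor $L^2$ comes from comparison with a long-range process whose gap is explicit, followed
by a path argument that tolerates disorder.

Long-range gap. Let a particle at $x$ jump to any empty $y$ at rate $r_y=e^{\alpha_y}$. This is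
reversible for the canonical measure. For a nonconstant eigenfunction $g$, take a configuration and
a jump $a\to b$ at which $g$ drops the most, by $M$. Couple the processes started before and after
this jump by interchanging the labels $a$ and $b$ (`coupled_jump_le`). Every jump out of $a$ or into
$b$ lowers the difference of generators by at least $cM$, where $c\le r$, and no other pair of jumps
raises it. The holes available to $a$ and the particles able to reach $b$ together number $|V|$, so
every nonzero eigenvalue is at least $c|V|$ (`le_jumpGenerator_eigenvalue`). Hence
`sector_poincare`, with gap of order $L^d$.

Moves along a line. The long moves must now be decomposed into nearest neighbour moves. A move $u\to
v$ splits at an intermediate $y$: an empty $y$ is a stop, an occupied $y$ sends its own particle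
ahead (`moveForm_le_three_sites`). In the second case the weights change by ratios of rates, which
would compound along a path if the splitting points were arbitrary. Splitting always at the interior
minimum of $r$ makes these ratios telescope, so a path of length $n$ costs at most a constant times
$n$ times the sum of its steps (`path_le`).

Counting. Changing coordinates one at a time joins any two sites of the box by at most $d$ line
segments. A nearest neighbour step is used by at most order $L\cdot L^d$ pairs, and each segment has
length at most $L$ (`sum_pairs_le`, `sum_moveForm_le`). The resulting factor $L^{d+2}$, divided by
the gap of order $L^d$, leaves $L^2$. -/

namespace InhomBernoulli

/-! ### Spectral theorem for reversible generators -/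

/-- Poincaré inequality from a lower bound on the eigenvalues of a reversible generator. -/
lemma poincare_of_eigenvalue_bound {Ω : Type*} [Fintype Ω] [DecidableEq Ω]
    (π : Ω → ℝ) (hπ : ∀ ω, 0 < π ω) (L : (Ω → ℝ) →ₗ[ℝ] (Ω → ℝ))
    (hsymm : ∀ f g, ∑ ω, π ω * f ω * L g ω = ∑ ω, π ω * g ω * L f ω)
    (hone : L (fun _ => 1) = 0) (c : ℝ)
    (heig : ∀ (g : Ω → ℝ) (κ : ℝ), g ≠ 0 → ∑ ω, π ω * g ω = 0 →
      (∀ ω, L g ω = -κ * g ω) → c ≤ κ)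
    (f : Ω → ℝ) (hf : ∑ ω, π ω * f ω = 0) :
    c * ∑ ω, π ω * f ω ^ 2 ≤ -∑ ω, π ω * f ω * L f ω := by
  set s : Ω → ℝ := fun ω => Real.sqrt (π ω) with hs
  have hspos : ∀ ω, 0 < s ω := fun ω => Real.sqrt_pos.2 (hπ ω)
  have hsq : ∀ ω, s ω * s ω = π ω := fun ω => Real.mul_self_sqrt (hπ ω).le
  set m : ℝ := ∑ ω, π ω with hm
  -- Conjugation by $s=\sqrt\pi$ makes $-L-c$ symmetric for the standard inner product. The rank-one
  -- term restores the $c$ subtracted along $s$, the image of the constants, so that $Ts=0$. The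
  -- claim becomes $T\ge 0$.
  let T : (Ω → ℝ) →ₗ[ℝ] (Ω → ℝ) :=
    { toFun := fun u ω => s ω * -(L (fun z => u z / s z) ω) - c * u ω
        + c / m * s ω * ∑ z, s z * u z
      map_add' := by
        intro u v
        have h : L (fun z => (u z + v z) / s z) =
            L (fun z => u z / s z) + L (fun z => v z / s z) := by
          rw [← map_add]; congr 1; ext z; simp [add_div]
        ext ω
        simp only [Pi.add_apply, h, mul_add, Finset.sum_add_distrib]
        ring
      map_smul' := by
        intro r u
        have h : L (fun z => r * u z / s z) = r • L (fun z => u z / s z) := by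
          rw [← map_smul]; congr 1; ext z; simp [mul_div_assoc]
        ext ω
        simp only [Pi.smul_apply, smul_eq_mul, h, RingHom.id_apply, mul_add,
          Finset.mul_sum]
        congr 1
        · ring
        · exact Finset.sum_congr rfl fun z _ => by ring }
  have hT : ∀ u ω, T u ω = s ω * -(L (fun z => u z / s z) ω) - c * u ω
        + c / m * s ω * ∑ z, s z * u z := fun _ _ => rfl
  have hform : ∀ u v : Ω → ℝ, ∑ ω, v ω * T u ω =
      -(∑ ω, π ω * (v ω / s ω) * L (fun z => u z / s z) ω) - c * ∑ ω, u ω * v ω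
        + c / m * (∑ z, s z * v z) * ∑ z, s z * u z := by
    intro u v
    simp only [hT, ← Finset.sum_neg_distrib, Finset.mul_sum _ _ c, ← Finset.sum_sub_distrib]
    rw [Finset.mul_sum _ _ (c / m), Finset.sum_mul, ← Finset.sum_add_distrib]
    refine Finset.sum_congr rfl fun ω _ => ?_
    have : π ω * (v ω / s ω) = v ω * s ω := by
      rw [← hsq]; field_simp [(hspos ω).ne']
    rw [this]; ring
  have hTsymm : ∀ u v : Ω → ℝ, ∑ ω, v ω * T u ω = ∑ ω, u ω * T v ω := by
    intro u v
    rw [hform, hform, hsymm]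
    have : ∑ ω, u ω * v ω = ∑ ω, v ω * u ω := Finset.sum_congr rfl fun _ _ => mul_comm _ _
    rw [this]; ring
  have hH : (LinearMap.toMatrix' T).IsHermitian := by
    ext i j
    have := hTsymm (Pi.single i 1) (Pi.single j 1)
    simpa [Pi.single_apply, LinearMap.toMatrix'_apply, Matrix.conjTranspose_apply] using this
  have hpsd : (LinearMap.toMatrix' T).PosSemidef := by
    rw [hH.posSemidef_iff_eigenvalues_nonneg]
    intro j
    by_contra hneg
    simp only [Pi.zero_apply, not_le] at hneg
    set θ := hH.eigenvalues j
    set u : Ω → ℝ := (hH.eigenvectorBasis j).ofLp with hu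
    have hTu : T u = θ • u := by
      rw [← LinearMap.toMatrix'_mulVec]
      exact hH.mulVec_eigenvectorBasis j
    have hu0 : u ≠ 0 := by
      intro h0
      have := hH.eigenvectorBasis.orthonormal.ne_zero j
      exact this (by ext ω; exact congrFun h0 ω)
    -- Since $Ts=0$ and $T$ is symmetric, an eigenvector with nonzero eigenvalue is orthogonal to
    -- $s$; after undoing the conjugation it has mean zero.
    have hs0 : ∑ ω, s ω * u ω = 0 := by
      have h1 := hform u s
      have h2 : (fun z => s z / s z) = fun _ => (1 : ℝ) := by
        ext z; exact div_self (hspos z).ne'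
      have h3 : ∑ ω, π ω * (s ω / s ω) * L (fun z => u z / s z) ω = 0 := by
        rw [hsymm (fun ω => s ω / s ω), h2, hone]; simp
      have h4 : ∑ z, s z * s z = m := Finset.sum_congr rfl fun ω _ => hsq ω
      have hm0 : m ≠ 0 := by
        have : Nonempty Ω := ⟨j⟩
        exact (Finset.sum_pos (fun ω _ => hπ ω) Finset.univ_nonempty).ne'
      have h5 : ∑ ω, u ω * s ω = ∑ ω, s ω * u ω :=
        Finset.sum_congr rfl fun _ _ => mul_comm _ _
      rw [h3, h4, h5, hTu, div_mul_cancel₀ _ hm0] at h1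
      have h6 : ∑ ω, s ω * (θ • u) ω = θ * ∑ ω, s ω * u ω := by
        rw [Finset.mul_sum]
        exact Finset.sum_congr rfl fun ω _ => by simp only [Pi.smul_apply, smul_eq_mul]; ring
      rw [h6] at h1
      have h7 : θ * ∑ ω, s ω * u ω = 0 := by linarith
      exact (mul_eq_zero.1 h7).resolve_left hneg.ne
    -- On the complement of $s$ the rank-one term vanishes, so $u/s$ is an eigenfunction of $-L$
    -- with eigenvalue $c+\theta<c$.
    have := heig (fun z => u z / s z) (c + θ) ?_ ?_ ?_
    · linarith
    · intro h0
      apply hu0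
      ext ω
      have := congrFun h0 ω
      simpa [(hspos ω).ne'] using this
    · rw [← hs0]
      refine Finset.sum_congr rfl fun ω _ => ?_
      rw [← hsq]; field_simp [(hspos ω).ne']
    · intro ω
      have h1 := congrFun hTu ω
      rw [hT, hs0] at h1
      simp only [Pi.smul_apply, smul_eq_mul, mul_zero, add_zero] at h1
      have h2 := (hspos ω).ne'
      field_simp
      linarith
  have h1 := hpsd.dotProduct_mulVec_nonneg (fun ω => s ω * f ω)
  rw [LinearMap.toMatrix'_mulVec] at h1
  have h2 := hform (fun ω => s ω * f ω) (fun ω => s ω * f ω)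
  have h3 : (fun z => s z * f z / s z) = f := by
    ext z; exact mul_div_cancel_left₀ _ (hspos z).ne'
  have h4 : ∑ z, s z * (s z * f z) = 0 := by
    rw [← hf]; exact Finset.sum_congr rfl fun ω _ => by rw [← hsq]; ring
  have h5 : ∑ ω, s ω * f ω * (s ω * f ω) = ∑ ω, π ω * f ω ^ 2 :=
    Finset.sum_congr rfl fun ω _ => by rw [← hsq]; ring
  rw [h3, h4, h5] at h2
  have h6 : ∀ ω, s ω * f ω / s ω = f ω := fun ω => congrFun h3 ω
  simp only [h6] at h2
  simp only [dotProduct, star_trivial] at h1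
  linarith

/-! ### Configurations with a fixed number of particles -/

/-- Configurations on `V` with exactly `N` particles. -/
abbrev Sector (V : Type*) [Fintype V] (N : ℕ) : Type _ :=
  {η : V → Fin 2 // ∑ x, (η x : ℕ) = N}

/-- The exchange of the occupation numbers of two sites, on the configurations with `N`
particles. -/
def Sector.swap {V : Type*} [Fintype V] [DecidableEq V] {N : ℕ} (x y : V) (η : Sector V N) :
    Sector V N :=
  ⟨η.1 ∘ Equiv.swap x y, by
    exact (Equiv.sum_comp (Equiv.swap x y) fun z => (η.1 z : ℕ)).trans η.2⟩

lemma Sector.swap_swap {V : Type*} [Fintype V] [DecidableEq V] {N : ℕ} (x y : V)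
    (η : Sector V N) : (η.swap x y).swap x y = η := by
  apply Subtype.ext; funext z; simp [Sector.swap]

lemma Sector.swap_comm {V : Type*} [Fintype V] [DecidableEq V] {N : ℕ} (x y : V)
    (η : Sector V N) : η.swap x y = η.swap y x := by
  apply Subtype.ext; simp [Sector.swap, Equiv.swap_comm]

lemma Sector.swap_left {V : Type*} [Fintype V] [DecidableEq V] {N : ℕ} (x y : V)
    (η : Sector V N) : (η.swap x y).1 x = η.1 y := by
  simp [Sector.swap]

lemma Sector.swap_right {V : Type*} [Fintype V] [DecidableEq V] {N : ℕ} (x y : V)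
    (η : Sector V N) : (η.swap x y).1 y = η.1 x := by
  simp [Sector.swap]

lemma Sector.swap_of_ne {V : Type*} [Fintype V] [DecidableEq V] {N : ℕ} {x y z : V}
    (hx : z ≠ x) (hy : z ≠ y) (η : Sector V N) : (η.swap x y).1 z = η.1 z := by
  simp [Sector.swap, Equiv.swap_apply_of_ne_of_ne hx hy]

/-- The exchange as an equivalence. -/
def Sector.swapEquiv {V : Type*} [Fintype V] [DecidableEq V] {N : ℕ} (x y : V) :
    Sector V N ≃ Sector V N :=
  ⟨Sector.swap x y, Sector.swap x y, Sector.swap_swap x y, Sector.swap_swap x y⟩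

lemma Sector.sum_swap {V : Type*} [Fintype V] [DecidableEq V] {N : ℕ} (x y : V)
    (F : Sector V N → ℝ) : ∑ η : Sector V N, F (η.swap x y) = ∑ η : Sector V N, F η :=
  Equiv.sum_comp (Sector.swapEquiv x y) F

/-- A function on the configurations with `N` particles that is invariant under all exchanges
is constant. -/
lemma Sector.eq_of_swap_invariant {V : Type*} [Fintype V] [DecidableEq V] {N : ℕ}
    (g : Sector V N → ℝ) (hg : ∀ x y (η : Sector V N), g (η.swap x y) = g η)
    (η σ : Sector V N) : g η = g σ := by
  have hcount : ∀ τ : Sector V N, Fintype.card {x // τ.1 x = 1} = N := by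
    intro τ
    rw [Fintype.card_subtype, Finset.card_filter]
    refine Eq.trans (Finset.sum_congr rfl fun x _ => ?_) τ.2
    generalize τ.1 x = p
    fin_cases p <;> simp
  have hcount0 : ∀ τ : Sector V N, Fintype.card {x // τ.1 x = 0} = Fintype.card V - N := by
    intro τ
    have h := Fintype.card_subtype_compl fun x => τ.1 x = 1
    rw [hcount τ] at h
    rw [← h]
    refine Fintype.card_congr (Equiv.subtypeEquivRight fun x => ?_)
    generalize τ.1 x = p
    fin_cases p <;> simp
  have hfib : ∀ c : Fin 2, Nonempty ({x // η.1 x = c} ≃ {x // σ.1 x = c}) := by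
    intro c
    rw [← Fintype.card_eq]
    fin_cases c
    · simpa using (hcount0 η).trans (hcount0 σ).symm
    · simpa using (hcount η).trans (hcount σ).symm
  -- Equal numbers of particles and of holes give a permutation carrying one configuration to the
  -- other; transpositions generate it.
  let e : Equiv.Perm V := Equiv.ofFiberEquiv fun c => (hfib c).some
  have he : η.1 = σ.1 ∘ e := by
    funext x; exact (Equiv.ofFiberEquiv_map _ x).symm
  have key : ∀ (e : Equiv.Perm V) (η σ : Sector V N), η.1 = σ.1 ∘ e → g η = g σ := by
    intro e
    induction e using Equiv.Perm.swap_induction_on with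
    | one => intro η σ h; congr 1; exact Subtype.ext h
    | swap_mul f x y _ ih =>
      intro η σ h
      rw [← hg x y σ]
      exact ih η _ (by rw [h]; rfl)
  exact key e η σ he

/-! ### Gap of the long-range jump process, by coupling -/

/-- The generator of the process in which a particle at `x` jumps to an empty site `y` at
rate `r y`, whatever the distance. -/
def jumpGenerator {V : Type*} [Fintype V] [DecidableEq V] (N : ℕ) (r : V → ℝ) :
    (Sector V N → ℝ) →ₗ[ℝ] (Sector V N → ℝ) where
  toFun g η := ∑ x, ∑ y, if η.1 x = 1 ∧ η.1 y = 0 then r y * (g (η.swap x y) - g η) else 0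
  map_add' g h := by
    ext η
    simp only [Pi.add_apply, ← Finset.sum_add_distrib]
    refine Finset.sum_congr rfl fun x _ => Finset.sum_congr rfl fun y _ => ?_
    split_ifs <;> ring
  map_smul' c g := by
    ext η
    simp only [Pi.smul_apply, smul_eq_mul, Finset.mul_sum, RingHom.id_apply]
    refine Finset.sum_congr rfl fun x _ => Finset.sum_congr rfl fun y _ => ?_
    split_ifs <;> ring

/-- Hypothesis `hW` is detailed balance. The substitution $\eta\mapsto\eta^{xy}$ turns the $(x,y)$
term into the reversed $(y,x)$ term, and averaging the two expressions gives the Dirichlet form. -/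
lemma sum_mul_jumpGenerator {V : Type*} [Fintype V] [DecidableEq V] (N : ℕ) (r : V → ℝ)
    (W : (V → Fin 2) → ℝ)
    (hW : ∀ η x y, η x = 1 → η y = 0 → W η * r y = W (η ∘ Equiv.swap x y) * r x)
    (g h : Sector V N → ℝ) :
    ∑ η : Sector V N, W η.1 * g η * jumpGenerator N r h η =
      -(1 / 2) * ∑ x, ∑ y, ∑ η : Sector V N, if η.1 x = 1 ∧ η.1 y = 0 then
        W η.1 * r y * ((g (η.swap x y) - g η) * (h (η.swap x y) - h η)) else 0 := by
  set A : V → V → ℝ := fun x y => ∑ η : Sector V N, if η.1 x = 1 ∧ η.1 y = 0 then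
        W η.1 * r y * (g η * (h (η.swap x y) - h η)) else 0 with hA
  set B : V → V → ℝ := fun x y => ∑ η : Sector V N, if η.1 x = 1 ∧ η.1 y = 0 then
        W η.1 * r y * (g (η.swap x y) * (h η - h (η.swap x y))) else 0 with hB
  have hAB : ∀ x y, A x y = B y x := by
    intro x y
    simp only [hA, hB]
    rw [← Sector.sum_swap x y]
    refine Finset.sum_congr rfl fun η _ => ?_
    rw [Sector.swap_left, Sector.swap_right, Sector.swap_swap, ← Sector.swap_comm x y]
    by_cases hc : η.1 y = 1 ∧ η.1 x = 0
    · rw [if_pos hc, if_pos hc]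
      have := hW η.1 y x hc.1 hc.2
      rw [Equiv.swap_comm] at this
      have h2 : W (η.swap x y).1 = W (η.1 ∘ Equiv.swap x y) := rfl
      rw [h2, ← this]
    · rw [if_neg hc, if_neg hc]
  have h1 : ∑ η : Sector V N, W η.1 * g η * jumpGenerator N r h η = ∑ x, ∑ y, A x y := by
    simp only [hA, jumpGenerator, LinearMap.coe_mk, AddHom.coe_mk, Finset.mul_sum]
    rw [Finset.sum_comm]
    refine Finset.sum_congr rfl fun x _ => ?_
    rw [Finset.sum_comm]
    refine Finset.sum_congr rfl fun y _ => Finset.sum_congr rfl fun η _ => ?_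
    split_ifs <;> ring
  have h2 : ∑ x, ∑ y, A x y = ∑ x, ∑ y, B x y := by
    simp only [hAB]; rw [Finset.sum_comm]
  have h3 : ∑ x, ∑ y, A x y + ∑ x, ∑ y, B x y =
      -∑ x, ∑ y, ∑ η : Sector V N, if η.1 x = 1 ∧ η.1 y = 0 then
        W η.1 * r y * ((g (η.swap x y) - g η) * (h (η.swap x y) - h η)) else 0 := by
    simp only [← Finset.sum_add_distrib, ← Finset.sum_neg_distrib, hA, hB]
    refine Finset.sum_congr rfl fun x _ => Finset.sum_congr rfl fun y _ =>
      Finset.sum_congr rfl fun η _ => ?_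
    split_ifs <;> ring
  rw [h1]
  linarith

/-- The coupled difference of one pair of jumps. -/
lemma coupled_jump_le {V : Type*} [Fintype V] [DecidableEq V] {N : ℕ} (r : V → ℝ)
    {c : ℝ} (hc : 0 < c) (hr : ∀ x, c ≤ r x) (g : Sector V N → ℝ) {M : ℝ} (hM : 0 ≤ M)
    (hg : ∀ (η : Sector V N) x y, η.1 x = 1 → η.1 y = 0 → g η - g (η.swap x y) ≤ M)
    (η : Sector V N) (a b : V) (ha : η.1 a = 1) (hb : η.1 b = 0)
    (hab : g η - g (η.swap a b) = M) (x y : V) (hx : η.1 x = 1) (hy : η.1 y = 0) :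
    r y * (g (η.swap x y) - g η) -
      r (Equiv.swap a b y) * (g ((η.swap x y).swap a b) - g (η.swap a b)) ≤
    -(c * M) * ((if x = a then 1 else 0) + if y = b then 1 else 0) := by
  have hg' : ∀ (η : Sector V N) x y, η.1 x = 1 → η.1 y = 0 → g (η.swap x y) - g η ≤ M := by
    intro η x y hx hy
    have := hg (η.swap x y) y x (by rwa [Sector.swap_right]) (by rwa [Sector.swap_left])
    rwa [Sector.swap_comm y x, Sector.swap_swap] at this
  have hxb : x ≠ b := by rintro rfl; rw [hb] at hx; exact absurd hx (by decide)
  have hya : y ≠ a := by rintro rfl; rw [ha] at hy; exact absurd hy (by decide)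
  have hab' : a ≠ b := by rintro rfl; rw [ha] at hb; exact absurd hb (by decide)
  by_cases hxa : x = a
  · subst hxa
    by_cases hyb : y = b
    · subst hyb
      -- The two copies trade places, contributing $-(r_a+r_b)M\le-2cM$.
      rw [Sector.swap_swap, Equiv.swap_apply_right]
      simp only [if_true]
      nlinarith [hr x, hr y]
    · rw [Equiv.swap_apply_of_ne_of_ne hya hyb]
      -- The extra particle leaves $a$ in one copy and $b$ in the other, both at rate $r_y$; the
      -- copies merge.
      have : (η.swap x y).swap x b = η.swap x y := by
        apply Subtype.ext; funext z
        change (η.swap x y).1 (Equiv.swap x b z) = (η.swap x y).1 z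
        have e1 : (η.swap x y).1 x = 0 := by rw [Sector.swap_left, hy]
        have e2 : (η.swap x y).1 b = 0 := by rw [Sector.swap_of_ne hab'.symm (Ne.symm hyb), hb]
        rw [Equiv.swap_apply_def]
        split_ifs with h1 h2
        · rw [h1, e1, e2]
        · rw [h2, e1, e2]
        · rfl
      rw [this]
      simp only [if_true, if_neg hyb]
      nlinarith [hr y]
  · by_cases hyb : y = b
    · subst hyb
      rw [Equiv.swap_apply_right]
      -- The copies merge in a common configuration, but at different rates $r_b$ and $r_a$. The
      -- drops of $g$ from $\eta$ to it and from it to $\eta^{ab}$ add up to $M$. Each is at most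
      -- $M$ by maximality, so both are nonnegative, and replacing either rate by $c$ is harmless.
      have h0 : (η.swap x y).swap a y = η.swap x y := by
        apply Subtype.ext; funext z
        change (η.swap x y).1 (Equiv.swap a y z) = (η.swap x y).1 z
        have e1 : (η.swap x y).1 a = 1 := by rw [Sector.swap_of_ne (Ne.symm hxa) hab', ha]
        have e2 : (η.swap x y).1 y = 1 := by rw [Sector.swap_right, hx]
        rw [Equiv.swap_apply_def]
        split_ifs with h1 h2
        · rw [h1, e1, e2]
        · rw [h2, e1, e2]
        · rfl
      have h1 := hg η x y hx hy
      have h2 : g (η.swap x y) - g (η.swap a y) ≤ M := by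
        have e : (η.swap a y).swap x a = η.swap x y := by
          apply Subtype.ext; funext z
          change η.1 (Equiv.swap a y (Equiv.swap x a z)) = η.1 (Equiv.swap x y z)
          by_cases z1 : z = x
          · subst z1; simp
          by_cases z2 : z = a
          · subst z2
            rw [Equiv.swap_apply_right, Equiv.swap_apply_of_ne_of_ne hxa hxb,
              Equiv.swap_apply_of_ne_of_ne (Ne.symm hxa) hab', hx, ha]
          rw [Equiv.swap_apply_of_ne_of_ne z1 z2]
          by_cases z3 : z = y
          · subst z3; simp [hx, ha]
          · rw [Equiv.swap_apply_of_ne_of_ne z2 z3, Equiv.swap_apply_of_ne_of_ne z1 z3]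
        rw [← e]
        refine hg' (η.swap a y) x a ?_ ?_
        · rw [Sector.swap_of_ne hxa hxb, hx]
        · rw [Sector.swap_left, hb]
      rw [h0]
      simp only [if_true, if_neg hxa]
      nlinarith [hr a, hr y]
    · rw [Equiv.swap_apply_of_ne_of_ne hya hyb]
      -- Neither end of the jump involves $a$ or $b$: the copies still differ by $a\to b$, and
      -- maximality of $M$ shows that the difference has not grown.
      have h1 := hg (η.swap x y) a b
        (by rw [Sector.swap_of_ne (Ne.symm hxa) (Ne.symm hya), ha])
        (by rw [Sector.swap_of_ne (Ne.symm hxb) (Ne.symm hyb), hb])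
      simp only [if_neg hxa, if_neg hyb]
      have := hr y
      nlinarith

/-- Conjugation of transpositions: this identifies the target of the relabelled jump in the
coupling. -/
lemma Sector.swap_conj {V : Type*} [Fintype V] [DecidableEq V] {N : ℕ} (η : Sector V N)
    (a b x y : V) :
    (η.swap a b).swap (Equiv.swap a b x) (Equiv.swap a b y) = (η.swap x y).swap a b := by
  apply Subtype.ext; funext z
  change η.1 (Equiv.swap a b (Equiv.swap (Equiv.swap a b x) (Equiv.swap a b y) z)) =
    η.1 (Equiv.swap x y (Equiv.swap a b z))
  have := Equiv.swap_apply_apply (Equiv.swap a b) x y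
  rw [this]
  simp

/-- Nonzero eigenvalues of the jump generator are at least `c` times the number of sites. -/
lemma le_jumpGenerator_eigenvalue {V : Type*} [Fintype V] [DecidableEq V] {N : ℕ} (r : V → ℝ)
    {c : ℝ} (hc : 0 < c) (hr : ∀ x, c ≤ r x) (W : (V → Fin 2) → ℝ) (hW : ∀ η, 0 < W η)
    (g : Sector V N → ℝ) (κ : ℝ) (hg0 : g ≠ 0) (hmean : ∑ η : Sector V N, W η.1 * g η = 0)
    (hL : ∀ η, jumpGenerator N r g η = -κ * g η) : c * Fintype.card V ≤ κ := by
  have hnonconst : ∃ (η : Sector V N) (x y : V), g (η.swap x y) ≠ g η := by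
    by_contra! hcon
    apply hg0
    have hconst := Sector.eq_of_swap_invariant g fun x y η => hcon η x y
    funext η
    have h1 : ∑ σ : Sector V N, W σ.1 * g σ = (∑ σ : Sector V N, W σ.1) * g η := by
      rw [Finset.sum_mul]
      exact Finset.sum_congr rfl fun σ _ => by rw [hconst σ η]
    have h2 : 0 < ∑ σ : Sector V N, W σ.1 :=
      Finset.sum_pos (fun σ _ => hW _) ⟨η, Finset.mem_univ _⟩
    rw [hmean] at h1
    exact (mul_eq_zero.1 h1.symm).resolve_left h2.ne'
  set S : Finset (Sector V N × V × V) :=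
    Finset.univ.filter fun p => p.1.1 p.2.1 = 1 ∧ p.1.1 p.2.2 = 0 with hS
  set G : Sector V N × V × V → ℝ := fun p => g p.1 - g (p.1.swap p.2.1 p.2.2) with hG
  have hpos : ∃ p ∈ S, 0 < G p := by
    obtain ⟨η, x, y, hne⟩ := hnonconst
    have hxy : η.1 x ≠ η.1 y := by
      intro h
      apply hne
      congr 1
      apply Subtype.ext; funext z
      change η.1 (Equiv.swap x y z) = η.1 z
      rw [Equiv.swap_apply_def]
      split_ifs with h1 h2
      · rw [h1, h]
      · rw [h2, h]
      · rfl
    wlog h : η.1 x = 1 ∧ η.1 y = 0 generalizing x y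
    · have h' : η.1 y = 1 ∧ η.1 x = 0 := by
        revert h hxy
        generalize η.1 x = p
        generalize η.1 y = q
        revert p q; decide
      exact this y x (by rwa [Sector.swap_comm]) hxy.symm h'
    rcases lt_or_gt_of_ne hne with h1 | h1
    · exact ⟨(η, x, y), by simpa [hS] using h, by simpa [hG] using h1⟩
    · refine ⟨(η.swap x y, y, x), ?_, ?_⟩
      · simpa [hS, Sector.swap_left, Sector.swap_right] using h
      · simpa [hG, Sector.swap_comm y x, Sector.swap_swap] using h1
  obtain ⟨p₀, hp₀, hp₀pos⟩ := hpos
  obtain ⟨⟨η, a, b⟩, hmem, hmax⟩ := S.exists_max_image G ⟨p₀, hp₀⟩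
  set M : ℝ := G (η, a, b) with hMdef
  have hM : 0 < M := hp₀pos.trans_le (hmax _ hp₀)
  have hab : η.1 a = 1 ∧ η.1 b = 0 := by simpa [hS] using hmem
  have hcoup := coupled_jump_le r hc hr g hM.le
    (fun σ x y hx hy => hmax (σ, x, y) (by simp [hS, hx, hy])) η a b hab.1 hab.2 rfl
  have h1 : jumpGenerator N r g (η.swap a b) = ∑ x, ∑ y, if η.1 x = 1 ∧ η.1 y = 0 then
      r (Equiv.swap a b y) * (g ((η.swap x y).swap a b) - g (η.swap a b)) else 0 := by
    simp only [jumpGenerator, LinearMap.coe_mk, AddHom.coe_mk]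
    rw [← Equiv.sum_comp (Equiv.swap a b)]
    refine Finset.sum_congr rfl fun x _ => ?_
    rw [← Equiv.sum_comp (Equiv.swap a b)]
    refine Finset.sum_congr rfl fun y _ => ?_
    rw [Sector.swap_conj]
    have e : ∀ z, (η.swap a b).1 (Equiv.swap a b z) = η.1 z := by
      intro z
      change η.1 (Equiv.swap a b (Equiv.swap a b z)) = η.1 z
      simp
    rw [e, e]
  have h2 : jumpGenerator N r g η - jumpGenerator N r g (η.swap a b) ≤
      ∑ x, ∑ y, -(c * M) * (((if x = a then 1 else 0) * if η.1 y = 0 then 1 else 0) +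
        (if η.1 x = 1 then 1 else 0) * if y = b then 1 else 0) := by
    rw [h1]
    simp only [jumpGenerator, LinearMap.coe_mk, AddHom.coe_mk, ← Finset.sum_sub_distrib]
    refine Finset.sum_le_sum fun x _ => Finset.sum_le_sum fun y _ => ?_
    by_cases hxy : η.1 x = 1 ∧ η.1 y = 0
    · rw [if_pos hxy, if_pos hxy, if_pos hxy.1, if_pos hxy.2, mul_one, one_mul]
      exact hcoup x y hxy.1 hxy.2
    · rw [if_neg hxy, if_neg hxy]
      have e1 : ((if x = a then (1 : ℝ) else 0) * if η.1 y = 0 then 1 else 0) = 0 := by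
        by_cases hx : x = a
        · subst hx; simp [show ¬ η.1 y = 0 from fun h => hxy ⟨hab.1, h⟩]
        · simp [hx]
      have e2 : ((if η.1 x = 1 then (1 : ℝ) else 0) * if y = b then 1 else 0) = 0 := by
        by_cases hy : y = b
        · subst hy; simp [show ¬ η.1 x = 1 from fun h => hxy ⟨h, hab.2⟩]
        · simp [hy]
      rw [e1, e2]; simp
  -- The term $x=a$ counts the holes of $\eta$ and the term $y=b$ its particles: together, all
  -- sites.
  have h3 : ∑ x, ∑ y, -(c * M) * (((if x = a then (1 : ℝ) else 0) *
        if η.1 y = 0 then 1 else 0) + (if η.1 x = 1 then 1 else 0) * if y = b then 1 else 0) =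
      -(c * M) * Fintype.card V := by
    simp only [← Finset.mul_sum, Finset.sum_add_distrib]
    congr 1
    simp only [← Finset.sum_mul, Finset.sum_ite_eq', Finset.mem_univ, if_true, one_mul, mul_one,
      ← Finset.sum_add_distrib]
    rw [Fintype.card_eq_sum_ones, Nat.cast_sum]
    refine Finset.sum_congr rfl fun x _ => ?_
    generalize η.1 x = p
    fin_cases p <;> simp
  rw [hL, hL, h3] at h2
  have h4 : g η - g (η.swap a b) = M := rfl
  have h5 : -κ * M ≤ -(c * M) * Fintype.card V := by rw [← h4] at h2 ⊢; linarith
  nlinarith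

/-- Uniform Poincaré inequality for exchanges over arbitrary distances. -/
theorem sector_poincare {V : Type*} [Fintype V] [DecidableEq V] (N : ℕ) (r : V → ℝ)
    {c : ℝ} (hc : 0 < c) (hr : ∀ x, c ≤ r x) (W : (V → Fin 2) → ℝ) (hWpos : ∀ η, 0 < W η)
    (hW : ∀ η x y, η x = 1 → η y = 0 → W η * r y = W (η ∘ Equiv.swap x y) * r x)
    (f : Sector V N → ℝ) (hf : ∑ η : Sector V N, W η.1 * f η = 0) :
    c * Fintype.card V * ∑ η : Sector V N, W η.1 * f η ^ 2 ≤
      1 / 2 * ∑ x, ∑ y, ∑ η : Sector V N, if η.1 x = 1 ∧ η.1 y = 0 then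
        W η.1 * r y * (f (η.swap x y) - f η) ^ 2 else 0 := by
  have h := poincare_of_eigenvalue_bound (fun η : Sector V N => W η.1) (fun η => hWpos _)
    (jumpGenerator N r) ?_ ?_ (c * Fintype.card V)
    (fun g κ hg0 hmean hL => le_jumpGenerator_eigenvalue r hc hr W hWpos g κ hg0 hmean hL) f hf
  · rw [sum_mul_jumpGenerator N r W hW] at h
    simp only [← sq] at h
    linarith
  · intro f g
    rw [sum_mul_jumpGenerator N r W hW, sum_mul_jumpGenerator N r W hW]
    simp only [mul_comm (f _ - f _)]
  · funext η; simp [jumpGenerator]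

/-! ### Splitting a move at an intermediate site -/

/-- Cauchy–Schwarz with free weights. Taking them proportional to the lengths of the two pieces of a
path keeps the cost linear in the length under repeated splitting. -/
lemma add_sq_le_div_add_div {a b p q : ℝ} (hp : 0 < p) (hq : 0 < q) (hpq : p + q = 1) :
    (a + b) ^ 2 ≤ 1 / p * a ^ 2 + 1 / q * b ^ 2 := by
  obtain rfl : q = 1 - p := by linarith
  rw [← sub_nonneg]
  have : 1 / p * a ^ 2 + 1 / (1 - p) * b ^ 2 - (a + b) ^ 2 =
      ((1 - p) * a - p * b) ^ 2 / (p * (1 - p)) := by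
    field_simp
    ring
  rw [this]
  positivity

/-- The part of the Dirichlet form due to a particle at `u` moving to an empty site `v`, with
the weight of the moving particle left out. -/
noncomputable def moveForm {V : Type*} [Fintype V] [DecidableEq V] (W : (V → Fin 2) → ℝ)
    (r : V → ℝ) (f : (V → Fin 2) → ℝ) (u v : V) : ℝ :=
  ∑ η : V → Fin 2, if η u = 1 ∧ η v = 0 then
    W η / r u * (f (η ∘ Equiv.swap u v) - f η) ^ 2 else 0

lemma sum_comp_swap {V : Type*} [Fintype V] [DecidableEq V] (x y : V)
    (F : (V → Fin 2) → ℝ) : ∑ η : V → Fin 2, F (η ∘ Equiv.swap x y) = ∑ η, F η :=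
  Equiv.sum_comp (Equiv.arrowCongr (Equiv.swap x y) (Equiv.refl (Fin 2))) F

lemma comp_swap_comp_swap {V : Type*} [DecidableEq V] (x y : V) (η : V → Fin 2) :
    (η ∘ Equiv.swap x y) ∘ Equiv.swap x y = η := by
  funext z; simp

lemma moveForm_nonneg {V : Type*} [Fintype V] [DecidableEq V] {W : (V → Fin 2) → ℝ}
    {r : V → ℝ} (hr : ∀ x, 0 < r x) (hW0 : ∀ η, 0 ≤ W η) (f : (V → Fin 2) → ℝ) (u v : V) :
    0 ≤ moveForm W r f u v := by
  refine Finset.sum_nonneg fun η _ => ?_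
  have := hr u
  have := hW0 η
  split_ifs <;> positivity

lemma moveForm_self {V : Type*} [Fintype V] [DecidableEq V] (W : (V → Fin 2) → ℝ)
    (r : V → ℝ) (f : (V → Fin 2) → ℝ) (u : V) : moveForm W r f u u = 0 := by
  refine Finset.sum_eq_zero fun η _ => if_neg ?_
  rintro ⟨h1, h2⟩
  rw [h1] at h2
  exact absurd h2 (by decide)

/-- By detailed balance $W(\eta)/r_u$ is unchanged when the particle moves from $u$ to $v$; this is
the purpose of dividing by $r_u$. -/
lemma moveForm_comm {V : Type*} [Fintype V] [DecidableEq V] {W : (V → Fin 2) → ℝ}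
    {r : V → ℝ} (hr : ∀ x, 0 < r x)
    (hW : ∀ η x y, η x = 1 → η y = 0 → W η * r y = W (η ∘ Equiv.swap x y) * r x)
    (f : (V → Fin 2) → ℝ) (u v : V) : moveForm W r f u v = moveForm W r f v u := by
  unfold moveForm
  rw [← sum_comp_swap u v]
  refine Finset.sum_congr rfl fun η _ => ?_
  rw [comp_swap_comp_swap]
  simp only [Function.comp_apply, Equiv.swap_apply_left, Equiv.swap_apply_right]
  by_cases h : η v = 1 ∧ η u = 0
  · rw [if_pos h, if_pos h]
    have h1 := hW η v u h.1 h.2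
    rw [Equiv.swap_comm v u] at h1 ⊢
    have := hr u
    have := hr v
    have h2 : W (η ∘ Equiv.swap u v) / r u = W η / r v := by
      field_simp; linarith
    rw [h2]; ring
  · rw [if_neg h, if_neg h]

/-- Decomposition of a move through an intermediate site `y`: an empty `y` is used as a stop,
and the particle at an occupied `y` moves first. -/
lemma moveForm_le_three_sites {V : Type*} [Fintype V] [DecidableEq V] {W : (V → Fin 2) → ℝ}
    {r : V → ℝ} (hr : ∀ x, 0 < r x) (hW0 : ∀ η, 0 ≤ W η)
    (hW : ∀ η x y, η x = 1 → η y = 0 → W η * r y = W (η ∘ Equiv.swap x y) * r x)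
    (f : (V → Fin 2) → ℝ) {u y v : V} (huy : u ≠ y) (hyv : y ≠ v) (huv : u ≠ v)
    {p q : ℝ} (hp : 0 < p) (hq : 0 < q) (hpq : p + q = 1) :
    moveForm W r f u v ≤ 1 / p * max 1 (r y / r v) * moveForm W r f u y +
      1 / q * max 1 (r y / r u) * moveForm W r f y v := by
  set T : V → V → (V → Fin 2) → ℝ := fun u v η => if η u = 1 ∧ η v = 0 then
    W η / r u * (f (η ∘ Equiv.swap u v) - f η) ^ 2 else 0 with hT
  have hT0 : ∀ u v η, 0 ≤ T u v η := by
    intro u v η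
    have := hr u
    have := hW0 η
    simp only [hT]
    split_ifs <;> positivity
  -- `A` collects the $u\to y$ moves and `B` the $y\to v$ moves, first for $y$ empty and then for
  -- $y$ occupied. In `A` the two kinds start from configurations with $v$ empty and $v$ occupied
  -- respectively, so together they are covered once by the $u,y$ form; in `B` the occupation of $u$
  -- separates them.
  set A : (V → Fin 2) → ℝ := fun η => (if η v = 0 then T u y η else 0) +
    if η y = 1 ∧ η v = 0 then T u y (η ∘ Equiv.swap y v) else 0 with hA
  set B : (V → Fin 2) → ℝ := fun η => (if η u = 1 then T y v η else 0) +
    if η y = 0 ∧ η u = 1 then T y v (η ∘ Equiv.swap u y) else 0 with hB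
  have hA0 : ∀ η, 0 ≤ A η := by
    intro η; simp only [hA]; refine add_nonneg ?_ ?_ <;> split_ifs <;> simp [hT0]
  have hB0 : ∀ η, 0 ≤ B η := by
    intro η; simp only [hB]; refine add_nonneg ?_ ?_ <;> split_ifs <;> simp [hT0]
  have hAsum : ∑ η, A η ≤ moveForm W r f u y := by
    simp only [hA, Finset.sum_add_distrib]
    have : ∑ η : V → Fin 2, (if η y = 1 ∧ η v = 0 then T u y (η ∘ Equiv.swap y v) else 0) =
        ∑ η : V → Fin 2, if η v = 1 ∧ η y = 0 then T u y η else 0 := by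
      rw [← sum_comp_swap y v]
      refine Finset.sum_congr rfl fun η _ => ?_
      rw [comp_swap_comp_swap]
      simp
    rw [this, ← Finset.sum_add_distrib]
    refine Finset.sum_le_sum fun η _ => ?_
    change _ ≤ T u y η
    have := hT0 u y η
    by_cases h : η v = 0
    · simp [h]
    · rw [if_neg h, zero_add]; split_ifs <;> linarith
  have hBsum : ∑ η, B η ≤ moveForm W r f y v := by
    simp only [hB, Finset.sum_add_distrib]
    have : ∑ η : V → Fin 2, (if η y = 0 ∧ η u = 1 then T y v (η ∘ Equiv.swap u y) else 0) =
        ∑ η : V → Fin 2, if η u = 0 ∧ η y = 1 then T y v η else 0 := by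
      rw [← sum_comp_swap u y]
      refine Finset.sum_congr rfl fun η _ => ?_
      rw [comp_swap_comp_swap]
      simp
    rw [this, ← Finset.sum_add_distrib]
    refine Finset.sum_le_sum fun η _ => ?_
    change _ ≤ T y v η
    have := hT0 y v η
    by_cases h : η u = 1
    · simp [h]
    · rw [if_neg h, zero_add]; split_ifs <;> linarith
  have hk1 : 1 ≤ max 1 (r y / r v) := le_max_left _ _
  have hk2 : 1 ≤ max 1 (r y / r u) := le_max_left _ _
  have hk1' : r y / r v ≤ max 1 (r y / r v) := le_max_right _ _
  have hk2' : r y / r u ≤ max 1 (r y / r u) := le_max_right _ _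
  set k1 := max 1 (r y / r v)
  set k2 := max 1 (r y / r u)
  have hru := hr u
  have hry := hr y
  have hrv := hr v
  have hpt : ∀ η, T u v η ≤ 1 / p * k1 * A η + 1 / q * k2 * B η := by
    intro η
    by_cases h : η u = 1 ∧ η v = 0
    swap
    · have : T u v η = 0 := if_neg h
      rw [this]
      have := hA0 η
      have := hB0 η
      positivity
    obtain ⟨hu, hv⟩ := h
    have hTuv : T u v η = W η / r u * (f (η ∘ Equiv.swap u v) - f η) ^ 2 := if_pos ⟨hu, hv⟩
    have hy : η y = 0 ∨ η y = 1 := by generalize η y = t; revert t; decide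
    have hW0η := hW0 η
    rcases hy with hy | hy
    · have hAη : A η = W η / r u * (f (η ∘ Equiv.swap u y) - f η) ^ 2 := by
        simp [hA, hT, hu, hv, hy]
      have hBη : B η = W η / r u * (f (η ∘ Equiv.swap u v) - f (η ∘ Equiv.swap u y)) ^ 2 := by
        have e1 : (η ∘ Equiv.swap u y) ∘ Equiv.swap y v = η ∘ Equiv.swap u v := by
          funext z
          simp only [Function.comp_apply]
          by_cases z1 : z = y
          · subst z1
            rw [Equiv.swap_apply_left, Equiv.swap_apply_of_ne_of_ne huv.symm hyv.symm,
              Equiv.swap_apply_of_ne_of_ne huy.symm hyv, hv, hy]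
          by_cases z2 : z = v
          · subst z2; simp
          rw [Equiv.swap_apply_of_ne_of_ne z1 z2]
          by_cases z3 : z = u
          · subst z3; simp [hy, hv]
          rw [Equiv.swap_apply_of_ne_of_ne z3 z1, Equiv.swap_apply_of_ne_of_ne z3 z2]
        have e2 : W (η ∘ Equiv.swap u y) / r y = W η / r u := by
          have := hW η u y hu hy
          field_simp; linarith
        have e3 : (η ∘ Equiv.swap u y) v = 0 := by
          simp [Equiv.swap_apply_of_ne_of_ne huv.symm hyv.symm, hv]
        have e4 : (η ∘ Equiv.swap u y) y = 1 := by simp [hu]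
        have e5 : T y v η = 0 := if_neg (by simp [hy])
        simp only [hB, e5, hy, hu]
        simp only [hT, e1, e2, e3, e4]
        simp
      have hsq := add_sq_le_div_add_div (a := f (η ∘ Equiv.swap u y) - f η)
        (b := f (η ∘ Equiv.swap u v) - f (η ∘ Equiv.swap u y)) hp hq hpq
      have hk : 1 / p * A η + 1 / q * B η ≤ 1 / p * k1 * A η + 1 / q * k2 * B η := by
        have := hA0 η
        have := hB0 η
        rw [mul_assoc, mul_assoc]
        gcongr <;> nlinarith
      refine le_trans ?_ hk
      rw [hTuv, hAη, hBη]
      have hw : 0 ≤ W η / r u := by positivity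
      calc _ = W η / r u * ((f (η ∘ Equiv.swap u y) - f η) +
            (f (η ∘ Equiv.swap u v) - f (η ∘ Equiv.swap u y))) ^ 2 := by ring
        _ ≤ W η / r u * _ := mul_le_mul_of_nonneg_left hsq hw
        _ = _ := by ring
    -- With $y$ occupied, the $y\to v$ move precedes the $u\to y$ move. The normalized weights now
    -- differ from $W/r_u$, which produces the factors $r_y/r_u$ and $r_y/r_v$.
    · have hBη : B η = W η / r y * (f (η ∘ Equiv.swap y v) - f η) ^ 2 := by
        simp [hB, hT, hu, hv, hy]
      have hAη : A η = W η * r v / (r y * r u) *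
          (f (η ∘ Equiv.swap u v) - f (η ∘ Equiv.swap y v)) ^ 2 := by
        have e1 : (η ∘ Equiv.swap y v) ∘ Equiv.swap u y = η ∘ Equiv.swap u v := by
          funext z
          simp only [Function.comp_apply]
          by_cases z1 : z = u
          · subst z1; simp
          by_cases z2 : z = y
          · subst z2
            rw [Equiv.swap_apply_right, Equiv.swap_apply_of_ne_of_ne huy huv,
              Equiv.swap_apply_of_ne_of_ne z1 hyv, hu, hy]
          rw [Equiv.swap_apply_of_ne_of_ne z1 z2]
          by_cases z3 : z = v
          · subst z3; simp [hy, hu]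
          rw [Equiv.swap_apply_of_ne_of_ne z2 z3, Equiv.swap_apply_of_ne_of_ne z1 z3]
        have e2 : W (η ∘ Equiv.swap y v) / r u = W η * r v / (r y * r u) := by
          have := hW η y v hy hv
          field_simp; linarith
        have e3 : (η ∘ Equiv.swap y v) u = 1 := by
          simp [Equiv.swap_apply_of_ne_of_ne huy huv, hu]
        have e4 : (η ∘ Equiv.swap y v) y = 0 := by simp [hv]
        have e5 : T u y η = 0 := if_neg (by simp [hy])
        simp only [hA, e5, hy, hv]
        simp only [hT, e1, e2, e3, e4]
        simp
      have hsq := add_sq_le_div_add_div (b := f (η ∘ Equiv.swap y v) - f η)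
        (a := f (η ∘ Equiv.swap u v) - f (η ∘ Equiv.swap y v)) hp hq hpq
      have hk : 1 / p * ((r y / r v) * A η) + 1 / q * ((r y / r u) * B η) ≤
          1 / p * k1 * A η + 1 / q * k2 * B η := by
        have := hA0 η
        have := hB0 η
        rw [mul_assoc, mul_assoc]
        gcongr
      refine le_trans ?_ hk
      rw [hTuv, hAη, hBη]
      have hw : 0 ≤ W η / r u := by positivity
      calc _ = W η / r u * ((f (η ∘ Equiv.swap u v) - f (η ∘ Equiv.swap y v)) +
            (f (η ∘ Equiv.swap y v) - f η)) ^ 2 := by ring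
        _ ≤ W η / r u * _ := mul_le_mul_of_nonneg_left hsq hw
        _ = _ := by field_simp
  calc moveForm W r f u v = ∑ η, T u v η := rfl
    _ ≤ ∑ η, (1 / p * k1 * A η + 1 / q * k2 * B η) := Finset.sum_le_sum fun η _ => hpt η
    _ = 1 / p * k1 * ∑ η, A η + 1 / q * k2 * ∑ η, B η := by
      rw [Finset.sum_add_distrib, Finset.mul_sum, Finset.mul_sum]
    _ ≤ _ := by gcongr

/-! ### Cost of a move along a path with inhomogeneous rates -/

/-- The recursion for the cost of moves along a path, with `y` splitting `[l, r]`, in the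
normalization by length. -/
lemma split_le {n : ℕ} {D : ℕ → ℕ → ℝ} {r : ℕ → ℝ}
    (h3 : ∀ l y m, l < y → y < m → m ≤ n → ∀ p q : ℝ, 0 < p → 0 < q → p + q = 1 →
      D l m ≤ 1 / p * max 1 (r y / r m) * D l y + 1 / q * max 1 (r y / r l) * D y m)
    {l y m : ℕ} (hly : l < y) (hym : y < m) (hm : m ≤ n) {H H₁ H₂ : ℝ}
    (hD : ∀ k, 0 ≤ D k (k + 1))
    (h₁ : D l y ≤ H₁ * (((y : ℝ) - l) * ∑ k ∈ Finset.Ico l y, D k (k + 1)))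
    (h₂ : D y m ≤ H₂ * (((m : ℝ) - y) * ∑ k ∈ Finset.Ico y m, D k (k + 1)))
    (hH₁ : max 1 (r y / r m) * H₁ ≤ H) (hH₂ : max 1 (r y / r l) * H₂ ≤ H) :
    D l m ≤ H * (((m : ℝ) - l) * ∑ k ∈ Finset.Ico l m, D k (k + 1)) := by
  have a1 : (0 : ℝ) < (y : ℝ) - l := sub_pos.2 (by exact_mod_cast hly)
  have a2 : (0 : ℝ) < (m : ℝ) - y := sub_pos.2 (by exact_mod_cast hym)
  have a3 : (0 : ℝ) < (m : ℝ) - l := by linarith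
  -- With $p,q$ the relative lengths, $1/p$ and $1/q$ turn each piece's length into the full length
  -- $m-l$, and the sums of steps simply add.
  have h := h3 l y m hly hym hm (((y : ℝ) - l) / (m - l)) (((m : ℝ) - y) / (m - l))
    (by positivity) (by positivity) (by field_simp; ring)
  have hS₁ : 0 ≤ ∑ k ∈ Finset.Ico l y, D k (k + 1) := Finset.sum_nonneg fun k _ => hD k
  have hS₂ : 0 ≤ ∑ k ∈ Finset.Ico y m, D k (k + 1) := Finset.sum_nonneg fun k _ => hD k
  rw [← Finset.sum_Ico_consecutive _ hly.le hym.le]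
  set S₁ := ∑ k ∈ Finset.Ico l y, D k (k + 1)
  set S₂ := ∑ k ∈ Finset.Ico y m, D k (k + 1)
  have k1 : 0 ≤ max 1 (r y / r m) := zero_le_one.trans (le_max_left _ _)
  have k2 : 0 ≤ max 1 (r y / r l) := zero_le_one.trans (le_max_left _ _)
  calc D l m ≤ _ := h
    _ ≤ 1 / (((y : ℝ) - l) / (m - l)) * max 1 (r y / r m) * (H₁ * ((y - l) * S₁)) +
        1 / (((m : ℝ) - y) / (m - l)) * max 1 (r y / r l) * (H₂ * ((m - y) * S₂)) := by
      gcongr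
    _ = (max 1 (r y / r m) * H₁) * ((m - l) * S₁) +
        (max 1 (r y / r l) * H₂) * ((m - l) * S₂) := by
      field_simp
    _ ≤ H * ((m - l) * S₁) + H * ((m - l) * S₂) := by gcongr
    _ = _ := by ring

lemma exists_interior_min (r : ℕ → ℝ) {l m : ℕ} (h : l + 1 < m) :
    ∃ y, l < y ∧ y < m ∧ ∀ k, l < k → k < m → r y ≤ r k := by
  obtain ⟨y, hy, hmin⟩ := (Finset.Ioo l m).exists_min_image r ⟨l + 1, by simp; omega⟩
  rw [Finset.mem_Ioo] at hy
  exact ⟨y, hy.1, hy.2, fun k h1 h2 => hmin k (Finset.mem_Ioo.2 ⟨h1, h2⟩)⟩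

lemma single_step_le {D : ℕ → ℕ → ℝ} {l : ℕ} {H : ℝ} (hD : ∀ k, 0 ≤ D k (k + 1))
    (hH : 1 ≤ H) :
    D l (l + 1) ≤ H * ((((l + 1 : ℕ) : ℝ) - l) * ∑ k ∈ Finset.Ico l (l + 1), D k (k + 1)) := by
  have := hD l
  simp
  nlinarith

/-- Moves across an interval whose interior rates dominate those of both end points. -/
lemma path_le_of_valley {n : ℕ} {D : ℕ → ℕ → ℝ} {r : ℕ → ℝ} {c Λ : ℝ} (hc : 0 < c)
    (hcr : ∀ k, c ≤ r k) (hrΛ : ∀ k, r k ≤ Λ)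
    (h3 : ∀ l y m, l < y → y < m → m ≤ n → ∀ p q : ℝ, 0 < p → 0 < q → p + q = 1 →
      D l m ≤ 1 / p * max 1 (r y / r m) * D l y + 1 / q * max 1 (r y / r l) * D y m)
    (hD : ∀ k, 0 ≤ D k (k + 1)) :
    ∀ (t l m : ℕ), m - l = t → l < m → m ≤ n → (∀ k, l < k → k < m → r l ≤ r k ∧ r m ≤ r k) →
      D l m ≤ Λ ^ 2 / (r l * r m) * (((m : ℝ) - l) * ∑ k ∈ Finset.Ico l m, D k (k + 1)) := by
  have hr : ∀ k, 0 < r k := fun k => hc.trans_le (hcr k)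
  intro t
  induction t using Nat.strong_induction_on with
  | _ t ih =>
  intro l m ht hlm hmn hint
  rcases Nat.eq_or_lt_of_le (Nat.succ_le_of_lt hlm) with h | h
  · subst h
    refine single_step_le hD ?_
    rw [one_le_div (mul_pos (hr _) (hr _)), sq]
    exact mul_le_mul (hrΛ _) (hrΛ _) (hr _).le ((hr l).le.trans (hrΛ l))
  · obtain ⟨y, hly, hym, hmin⟩ := exists_interior_min r h
    have hl := hr l
    have hm := hr m
    have hy := hr y
    refine split_le h3 hly hym hmn hD
      (ih (y - l) (by omega) l y rfl hly (by omega) fun k h1 h2 =>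
        ⟨(hint k h1 (by omega)).1, hmin k h1 (by omega)⟩)
      (ih (m - y) (by omega) y m rfl hym hmn fun k h1 h2 =>
        ⟨hmin k (by omega) h2, (hint k (by omega) h2).2⟩) ?_ ?_
    -- Exact telescoping: $\frac{r_y}{r_m}\cdot\frac{\Lambda^2}{r_l r_y}=\frac{\Lambda^2}{r_l r_m}$.
    -- The constant does not deteriorate with the depth of the recursion.
    · rw [max_eq_right ((one_le_div hm).2 (hint y hly hym).2)]
      apply le_of_eq; field_simp
    · rw [max_eq_right ((one_le_div hl).2 (hint y hly hym).1)]
      apply le_of_eq; field_simp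

/-- Moves across an interval whose interior rates dominate that of one end point. -/
lemma path_le_of_min_endpoint {n : ℕ} {D : ℕ → ℕ → ℝ} {r : ℕ → ℝ} {c Λ : ℝ} (hc : 0 < c)
    (hcr : ∀ k, c ≤ r k) (hrΛ : ∀ k, r k ≤ Λ)
    (h3 : ∀ l y m, l < y → y < m → m ≤ n → ∀ p q : ℝ, 0 < p → 0 < q → p + q = 1 →
      D l m ≤ 1 / p * max 1 (r y / r m) * D l y + 1 / q * max 1 (r y / r l) * D y m)
    (hD : ∀ k, 0 ≤ D k (k + 1)) :
    ∀ (t l m : ℕ), m - l = t → l < m → m ≤ n →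
      (∀ k, l < k → k < m → min (r l) (r m) ≤ r k) →
      D l m ≤ Λ ^ 2 / (c * min (r l) (r m)) *
        (((m : ℝ) - l) * ∑ k ∈ Finset.Ico l m, D k (k + 1)) := by
  have hr : ∀ k, 0 < r k := fun k => hc.trans_le (hcr k)
  have hvalley := path_le_of_valley hc hcr hrΛ h3 hD
  intro t
  induction t using Nat.strong_induction_on with
  | _ t ih =>
  intro l m ht hlm hmn hint
  have hl := hr l
  have hm := hr m
  rcases Nat.eq_or_lt_of_le (Nat.succ_le_of_lt hlm) with h | h
  · subst h
    refine single_step_le hD ?_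
    rw [one_le_div (mul_pos hc (lt_min hl hm)), sq]
    exact mul_le_mul ((hcr l).trans (hrΛ l)) ((min_le_left _ _).trans (hrΛ l))
      (le_min hl.le hm.le) (hl.le.trans (hrΛ l))
  · obtain ⟨y, hly, hym, hmin⟩ := exists_interior_min r h
    have hy := hr y
    have hS : 0 ≤ ((m : ℝ) - l) * ∑ k ∈ Finset.Ico l m, D k (k + 1) :=
      mul_nonneg (sub_nonneg.2 (by exact_mod_cast hlm.le)) (Finset.sum_nonneg fun k _ => hD k)
    by_cases hv : r l ≤ r y ∧ r m ≤ r y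
    · refine (hvalley _ l m ht hlm hmn fun k h1 h2 =>
        ⟨hv.1.trans (hmin k h1 h2), hv.2.trans (hmin k h1 h2)⟩).trans ?_
      refine mul_le_mul_of_nonneg_right ?_ hS
      refine div_le_div_of_nonneg_left (sq_nonneg _) (mul_pos hc (lt_min hl hm)) ?_
      rw [← min_mul_max (r l) (r m), mul_comm c]
      exact mul_le_mul_of_nonneg_left ((hcr l).trans (le_max_left _ _)) (le_min hl.le hm.le)
    · have hyint := hint y hly hym
      -- If $r_l\le r_y<r_m$, the bound with both end points applies on $[l,y]$ and the induction
      -- hypothesis on $[y,m]$, whose minimum is at $y$. The left factor is $1$, and on the right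
      -- $r_y/r_l$ trades $r_y$ for $r_l$. The other case is the mirror image.
      rcases le_total (r l) (r m) with hle | hle
      · rw [min_eq_left hle] at hyint hint ⊢
        have hym' : r y < r m := by
          by_contra! hcon; exact hv ⟨hyint, hcon⟩
        have h1 := hvalley _ l y rfl hly (by omega) fun k h1 h2 =>
          ⟨hint k h1 (by omega), hmin k h1 (by omega)⟩
        have h2 := ih (m - y) (by omega) y m rfl hym hmn fun k h1 h2 => by
          rw [min_eq_left hym'.le]; exact hmin k (by omega) h2
        rw [min_eq_left hym'.le] at h2
        refine split_le h3 hly hym hmn hD h1 h2 ?_ ?_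
        · rw [max_eq_left ((div_le_one hm).2 hym'.le), one_mul]
          refine div_le_div_of_nonneg_left (sq_nonneg _) (by positivity) ?_
          rw [mul_comm]
          exact mul_le_mul_of_nonneg_left (hcr y) hl.le
        · rw [max_eq_right ((one_le_div hl).2 hyint)]
          apply le_of_eq; field_simp
      · rw [min_eq_right hle] at hyint hint ⊢
        have hyl : r y < r l := by
          by_contra! hcon; exact hv ⟨hcon, hyint⟩
        have h2 := hvalley _ y m rfl hym hmn fun k h1 h2 =>
          ⟨hmin k (by omega) h2, hint k (by omega) h2⟩
        have h1 := ih (y - l) (by omega) l y rfl hly (by omega) fun k h1 h2 => by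
          rw [min_eq_right hyl.le]; exact hmin k h1 (by omega)
        rw [min_eq_right hyl.le] at h1
        refine split_le h3 hly hym hmn hD h1 h2 ?_ ?_
        · rw [max_eq_right ((one_le_div hm).2 hyint)]
          apply le_of_eq; field_simp
        · rw [max_eq_left ((div_le_one hl).2 hyl.le), one_mul]
          refine div_le_div_of_nonneg_left (sq_nonneg _) (by positivity) ?_
          exact mul_le_mul_of_nonneg_right (hcr y) hm.le

/-- The cost of a move along a path is at most a constant times its length times the sum of the
costs of its steps. -/
lemma path_le {n : ℕ} {D : ℕ → ℕ → ℝ} {r : ℕ → ℝ} {c Λ : ℝ} (hc : 0 < c)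
    (hcr : ∀ k, c ≤ r k) (hrΛ : ∀ k, r k ≤ Λ)
    (h3 : ∀ l y m, l < y → y < m → m ≤ n → ∀ p q : ℝ, 0 < p → 0 < q → p + q = 1 →
      D l m ≤ 1 / p * max 1 (r y / r m) * D l y + 1 / q * max 1 (r y / r l) * D y m)
    (hD : ∀ k, 0 ≤ D k (k + 1)) {l m : ℕ} (hlm : l < m) (hmn : m ≤ n) :
    D l m ≤ Λ ^ 3 / c ^ 3 * (((m : ℝ) - l) * ∑ k ∈ Finset.Ico l m, D k (k + 1)) := by
  have hr : ∀ k, 0 < r k := fun k => hc.trans_le (hcr k)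
  have hcΛ : c ≤ Λ := (hcr 0).trans (hrΛ 0)
  have hΛ : 0 < Λ := hc.trans_le hcΛ
  have hend := path_le_of_min_endpoint hc hcr hrΛ h3 hD
  rcases Nat.eq_or_lt_of_le (Nat.succ_le_of_lt hlm) with h | h
  · subst h
    refine single_step_le hD ?_
    rw [one_le_div (by positivity)]
    gcongr
  -- After one split at the interior minimum, $y$ is a dominated end point of both pieces, so the
  -- crude factor $\Lambda/c$ is paid only once.
  · obtain ⟨y, hly, hym, hmin⟩ := exists_interior_min r h
    refine split_le h3 hly hym hmn hD
      (hend _ l y rfl hly (by omega) fun k h1 h2 => (min_le_right _ _).trans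
        (hmin k h1 (by omega)))
      (hend _ y m rfl hym hmn fun k h1 h2 => (min_le_left _ _).trans
        (hmin k (by omega) h2)) ?_ ?_
    all_goals
      have key : ∀ a b s t, max 1 (r a / r b) * (Λ ^ 2 / (c * min (r s) (r t))) ≤
          Λ ^ 3 / c ^ 3 := by
        intro a b s t
        have h1 : max 1 (r a / r b) ≤ Λ / c := by
          refine max_le ((one_le_div hc).2 hcΛ) ?_
          exact div_le_div₀ hΛ.le (hrΛ a) hc (hcr b)
        have h2 : Λ ^ 2 / (c * min (r s) (r t)) ≤ Λ ^ 2 / (c * c) := by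
          refine div_le_div_of_nonneg_left (sq_nonneg _) (by positivity) ?_
          exact mul_le_mul_of_nonneg_left (le_min (hcr s) (hcr t)) hc.le
        calc _ ≤ Λ / c * (Λ ^ 2 / (c * c)) :=
              mul_le_mul h1 h2 (div_nonneg (sq_nonneg _)
                (mul_pos hc (lt_min (hr s) (hr t))).le) (by positivity)
          _ = _ := by field_simp
      exact key _ _ _ _

/-! ### From pairs of grid points to steps along lines -/

/-- The point with the first `k` coordinates of `y` and the remaining ones of `x`. -/
def hybrid {d : ℕ} {S : Type*} (k : ℕ) (x y : Fin d → S) : Fin d → S :=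
  fun i => if (i : ℕ) < k then y i else x i

lemma hybrid_succ {d : ℕ} {S : Type*} (j : Fin d) (x y : Fin d → S) :
    hybrid (j + 1) x y = Function.update (hybrid j x y) j (hybrid j y x j) := by
  funext i
  by_cases h : i = j
  · subst h; simp [hybrid]
  · have : (i : ℕ) ≠ j := fun e => h (Fin.ext e)
    rw [Function.update_of_ne h]
    simp only [hybrid]
    have e : (i : ℕ) < j + 1 ↔ (i : ℕ) < j := by omega
    simp [e]

lemma hybrid_hybrid {d : ℕ} {S : Type*} (k : ℕ) (x y : Fin d → S) :
    hybrid k (hybrid k x y) (hybrid k y x) = x := by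
  funext i
  simp only [hybrid]
  split_ifs <;> rfl

/-- The quasi-triangle inequality is iterated only $d$ times, so its constant enters as $A^d$,
independent of $L$. -/
lemma le_sum_hybrid {d : ℕ} {S : Type*} {D : (Fin d → S) → (Fin d → S) → ℝ}
    (hD0 : ∀ x y, 0 ≤ D x y) (hself : ∀ x, D x x = 0) {A : ℝ} (hA : 1 ≤ A)
    (htri : ∀ x y z, D x z ≤ A * (D x y + D y z)) (x y : Fin d → S) :
    D x y ≤ A ^ d * ∑ i : Fin d, D (hybrid i x y) (hybrid (i + 1) x y) := by
  have h : ∀ k, D x (hybrid k x y) ≤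
      A ^ k * ∑ j ∈ Finset.range k, D (hybrid j x y) (hybrid (j + 1) x y) := by
    intro k
    induction k with
    | zero =>
      have : hybrid 0 x y = x := by funext i; simp [hybrid]
      simp [this, hself]
    | succ k ih =>
      rw [Finset.sum_range_succ]
      have h1 := htri x (hybrid k x y) (hybrid (k + 1) x y)
      have h2 := hD0 (hybrid k x y) (hybrid (k + 1) x y)
      have h3 : 1 ≤ A ^ k := one_le_pow₀ hA
      calc _ ≤ _ := h1
        _ ≤ A * (A ^ k * ∑ j ∈ Finset.range k, D (hybrid j x y) (hybrid (j + 1) x y) +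
            A ^ k * D (hybrid k x y) (hybrid (k + 1) x y)) := by
          gcongr
          nlinarith
        _ = _ := by ring
  have hd := h d
  have : hybrid d x y = y := by funext i; simp [hybrid]
  rw [this, Finset.sum_range] at hd
  exact hd

/-- Exchanging the first $j$ coordinates of $x$ and $y$ is an involution on pairs. Hence the $j$-th
segments of all coordinate paths are as equidistributed as arbitrary pairs. -/
lemma sum_sum_hybrid {d L : ℕ} (j : ℕ) (F : (Fin d → Fin L) → (Fin d → Fin L) → ℝ) :
    ∑ x, ∑ y, F (hybrid j x y) (hybrid j y x) = ∑ x, ∑ y, F x y := by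
  let e : (Fin d → Fin L) × (Fin d → Fin L) ≃ (Fin d → Fin L) × (Fin d → Fin L) :=
    { toFun := fun p => (hybrid j p.1 p.2, hybrid j p.2 p.1)
      invFun := fun p => (hybrid j p.1 p.2, hybrid j p.2 p.1)
      left_inv := fun p => Prod.ext (hybrid_hybrid _ _ _) (hybrid_hybrid _ _ _)
      right_inv := fun p => Prod.ext (hybrid_hybrid _ _ _) (hybrid_hybrid _ _ _) }
  have := Equiv.sum_comp e fun p => F p.1 p.2
  rw [Fintype.sum_prod_type, Fintype.sum_prod_type] at this
  exact this

/-- Each $w$ lies on the line through $z$ for exactly $L$ choices of $z$. -/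
lemma sum_sum_update {d L : ℕ} (i : Fin d) (G : (Fin d → Fin L) → ℝ) :
    ∑ z, ∑ k, G (Function.update z i k) = L * ∑ w, G w := by
  let e : (Fin d → Fin L) × Fin L ≃ (Fin d → Fin L) × Fin L :=
    { toFun := fun p => (Function.update p.1 i p.2, p.1 i)
      invFun := fun p => (Function.update p.1 i p.2, p.1 i)
      left_inv := fun p => by simp
      right_inv := fun p => by simp }
  have := Equiv.sum_comp e fun p => G p.1
  rw [Fintype.sum_prod_type, Fintype.sum_prod_type] at this
  rw [Finset.mul_sum]
  simpa [e] using this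

/-- Comparison of all pairs of points of a grid with the steps `E i w` along the lines. -/
lemma sum_pairs_le {d L : ℕ} {D : (Fin d → Fin L) → (Fin d → Fin L) → ℝ}
    (hD0 : ∀ x y, 0 ≤ D x y) (hself : ∀ x, D x x = 0) {A : ℝ} (hA : 1 ≤ A)
    (htri : ∀ x y z, D x z ≤ A * (D x y + D y z)) {B : ℝ}
    (E : Fin d → (Fin d → Fin L) → ℝ)
    (hline : ∀ (x : Fin d → Fin L) (i : Fin d) (t : Fin L),
      D x (Function.update x i t) ≤ B * ∑ k, E i (Function.update x i k)) :
    ∑ x, ∑ y, D x y ≤ A ^ d * (B * L * (L : ℝ) ^ d) * ∑ i, ∑ w, E i w := by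
  have hA0 : 0 ≤ A ^ d := by positivity
  calc ∑ x, ∑ y, D x y
      ≤ ∑ x, ∑ y, A ^ d * ∑ i : Fin d, D (hybrid i x y) (hybrid (i + 1) x y) :=
        Finset.sum_le_sum fun x _ => Finset.sum_le_sum fun y _ =>
          le_sum_hybrid hD0 hself hA htri x y
    _ = A ^ d * ∑ i : Fin d, ∑ x, ∑ y, D (hybrid i x y) (hybrid (i + 1) x y) := by
        simp only [← Finset.mul_sum]
        congr 1
        symm
        rw [Finset.sum_comm]
        refine Finset.sum_congr rfl fun x _ => ?_
        rw [Finset.sum_comm]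
    _ = A ^ d * ∑ i : Fin d, ∑ z : Fin d → Fin L, ∑ z' : Fin d → Fin L,
          D z (Function.update z i (z' i)) := by
        congr 1
        refine Finset.sum_congr rfl fun i _ => ?_
        simp only [hybrid_succ]
        exact sum_sum_hybrid i fun z z' => D z (Function.update z i (z' i))
    _ ≤ A ^ d * ∑ i : Fin d, ∑ z : Fin d → Fin L, ∑ _z' : Fin d → Fin L,
          B * ∑ k, E i (Function.update z i k) := by
        gcongr with i _ z _ z' _
        exact hline z i (z' i)
    _ = _ := by
        simp only [Finset.sum_const, Finset.card_univ, Fintype.card_fun, Fintype.card_fin,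
          nsmul_eq_mul, ← Finset.mul_sum, sum_sum_update, Nat.cast_pow]
        ring

/-! ### Comparison of long and short moves in a box -/

open MeasureTheory ProbabilityTheory

/-- Coordinates on a box. -/
def boxEquiv {d : ℕ} (L : ℕ) (a : Fin d → ℤ) : (Fin d → Fin L) ≃ box L a where
  toFun u := ⟨fun i => a i + (u i : ℕ), by
    simp only [box, Fintype.mem_piFinset, Finset.mem_Ico]
    intro i
    have := (u i).2
    omega⟩
  invFun x i := ⟨(x.1 i - a i).toNat, by
    have h := x.2
    simp only [box, Fintype.mem_piFinset, Finset.mem_Ico] at h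
    have := h i
    omega⟩
  left_inv u := by funext i; simp
  right_inv x := by
    apply Subtype.ext; funext i
    have h := x.2
    simp only [box, Fintype.mem_piFinset, Finset.mem_Ico] at h
    have := h i
    simp only
    omega

lemma neighbour_boxEquiv_update {d L : ℕ} (a : Fin d → ℤ) (w : Fin d → Fin L) (i : Fin d)
    (h : (w i : ℕ) + 1 < L) :
    Neighbour (boxEquiv L a w : Fin d → ℤ)
      (boxEquiv L a (Function.update w i ⟨w i + 1, h⟩)) := by
  unfold Neighbour
  rw [Finset.sum_eq_single i]
  · simp [boxEquiv]
  · intro j _ hj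
    simp [boxEquiv, Function.update_of_ne hj]
  · simp

section Weights

variable {d L : ℕ} {a : Fin d → ℤ} {W : Config (box L a) → ℝ} {r : box L a → ℝ} {c Λ : ℝ}

lemma moveForm_quasi_triangle (hc : 0 < c) (hcr : ∀ x, c ≤ r x) (hrΛ : ∀ x, r x ≤ Λ)
    (hcΛ : c ≤ Λ) (hW0 : ∀ η, 0 ≤ W η)
    (hW : ∀ η x y, η x = 1 → η y = 0 → W η * r y = W (η ∘ Equiv.swap x y) * r x)
    (f : Config (box L a) → ℝ) (x y z : box L a) :
    moveForm W r f x z ≤ 2 * (Λ / c) * (moveForm W r f x y + moveForm W r f y z) := by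
  have hr : ∀ x, 0 < r x := fun x => hc.trans_le (hcr x)
  have hD := moveForm_nonneg hr hW0 f
  have h1 : 1 ≤ Λ / c := (one_le_div hc).2 hcΛ
  by_cases hxy : x = y
  · subst hxy
    rw [moveForm_self]
    nlinarith [hD x z]
  by_cases hyz : y = z
  · subst hyz
    rw [moveForm_self]
    nlinarith [hD x y]
  by_cases hxz : x = z
  · subst hxz
    rw [moveForm_self]
    have := hD x y
    have := hD y x
    positivity
  have h := moveForm_le_three_sites hr hW0 hW f hxy hyz hxz (p := 1 / 2) (q := 1 / 2)
    (by norm_num) (by norm_num) (by norm_num)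
  have hk : ∀ u v, max 1 (r u / r v) ≤ Λ / c := fun u v =>
    max_le h1 (div_le_div₀ ((hc.trans_le hcΛ).le) (hrΛ u) hc (hcr v))
  have e1 := mul_le_mul_of_nonneg_right (hk y z) (hD x y)
  have e2 := mul_le_mul_of_nonneg_right (hk y x) (hD y z)
  norm_num at h
  nlinarith

/-- The cost of the step from `w` to the next site of the box in the direction `i`. -/
noncomputable def stepForm (W : Config (box L a) → ℝ) (r : box L a → ℝ)
    (f : Config (box L a) → ℝ) (i : Fin d) (w : Fin d → Fin L) : ℝ :=
  if h : (w i : ℕ) + 1 < L then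
    moveForm W r f (boxEquiv L a w) (boxEquiv L a (Function.update w i ⟨w i + 1, h⟩)) else 0

lemma moveForm_line_le (hc : 0 < c) (hcr : ∀ x, c ≤ r x) (hrΛ : ∀ x, r x ≤ Λ)
    (hcΛ : c ≤ Λ) (hW0 : ∀ η, 0 ≤ W η)
    (hW : ∀ η x y, η x = 1 → η y = 0 → W η * r y = W (η ∘ Equiv.swap x y) * r x)
    (f : Config (box L a) → ℝ) (x : Fin d → Fin L) (i : Fin d) (t : Fin L) :
    moveForm W r f (boxEquiv L a x) (boxEquiv L a (Function.update x i t)) ≤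
      Λ ^ 3 / c ^ 3 * L * ∑ k, stepForm W r f i (Function.update x i k) := by
  have hr : ∀ x, 0 < r x := fun x => hc.trans_le (hcr x)
  have hΛ : 0 < Λ := hc.trans_le hcΛ
  have hD := moveForm_nonneg hr hW0 f
  have hL : 0 < L := t.pos
  -- The line is indexed by all of `ℕ`, frozen at its last site, so that the step out of the box is
  -- trivial and costs zero, matching the default of `stepForm`.
  set Γ : ℕ → box L a := fun k =>
    boxEquiv L a (Function.update x i ⟨min k (L - 1), by omega⟩) with hΓ
  have hΓfin : ∀ k : Fin L, Γ k = boxEquiv L a (Function.update x i k) := by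
    intro k
    simp only [hΓ]
    congr 2
    apply Fin.ext
    simp only
    omega
  have hΓinj : ∀ l m, l < m → m ≤ L - 1 → Γ l ≠ Γ m := by
    intro l m hlm hm h
    have h1 := congrFun ((boxEquiv L a).injective h) i
    simp only [Function.update_self, Fin.mk.injEq] at h1
    omega
  have hsum : ∑ k, stepForm W r f i (Function.update x i k) =
      ∑ k ∈ Finset.range L, moveForm W r f (Γ k) (Γ (k + 1)) := by
    rw [Finset.sum_range]
    refine Finset.sum_congr rfl fun k _ => ?_
    unfold stepForm
    split_ifs with h
    · simp only [Function.update_self] at h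
      rw [hΓfin, show ((k : ℕ) + 1) = ((⟨k + 1, h⟩ : Fin L) : ℕ) from rfl, hΓfin]
      simp
    · simp only [Function.update_self] at h
      have : Γ (k + 1) = Γ k := by
        simp only [hΓ]
        congr 3
        have := k.2
        omega
      rw [this, moveForm_self]
  have hpath : ∀ l m, l < m → m ≤ L - 1 → moveForm W r f (Γ l) (Γ m) ≤
      Λ ^ 3 / c ^ 3 * L * ∑ k, stepForm W r f i (Function.update x i k) := by
    intro l m hlm hm
    refine (path_le (D := fun l m => moveForm W r f (Γ l) (Γ m)) (r := fun k => r (Γ k)) hc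
      (fun k => hcr _) (fun k => hrΛ _) (n := L - 1) ?_ (fun k => hD _ _) hlm hm).trans ?_
    · intro l y m hly hym hm p q hp hq hpq
      exact moveForm_le_three_sites hr hW0 hW f (hΓinj l y hly (by omega)) (hΓinj y m hym hm)
        (hΓinj l m (by omega) hm) hp hq hpq
    · rw [hsum, mul_assoc]
      have h1 : ∑ k ∈ Finset.Ico l m, moveForm W r f (Γ k) (Γ (k + 1)) ≤
          ∑ k ∈ Finset.range L, moveForm W r f (Γ k) (Γ (k + 1)) := by
        refine Finset.sum_le_sum_of_subset_of_nonneg ?_ fun k _ _ => hD _ _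
        intro k hk
        rw [Finset.mem_Ico] at hk
        rw [Finset.mem_range]
        omega
      have h2 : ((m : ℝ) - l) ≤ L := by
        have : (m : ℝ) ≤ L := by exact_mod_cast (by omega : m ≤ L)
        have : (0 : ℝ) ≤ l := by positivity
        linarith
      have h3 : 0 ≤ ∑ k ∈ Finset.Ico l m, moveForm W r f (Γ k) (Γ (k + 1)) :=
        Finset.sum_nonneg fun k _ => hD _ _
      exact mul_le_mul_of_nonneg_left (mul_le_mul h2 h1 h3 (by positivity)) (by positivity)
  have hx : boxEquiv L a x = Γ (x i) := by rw [hΓfin]; simp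
  rw [hx, ← hΓfin]
  rcases lt_trichotomy (x i : ℕ) t with h | h | h
  · exact hpath _ _ h (by omega)
  · rw [h, moveForm_self, hsum]
    have := Finset.sum_nonneg fun k (_ : k ∈ Finset.range L) => hD (Γ k) (Γ (k + 1))
    positivity
  · rw [moveForm_comm hr hW]
    exact hpath _ _ h (by omega)

/-- Comparison of moves between all pairs of sites with moves between nearest neighbours. -/
lemma sum_moveForm_le (hc : 0 < c) (hcr : ∀ x, c ≤ r x) (hrΛ : ∀ x, r x ≤ Λ)
    (hcΛ : c ≤ Λ) (hW0 : ∀ η, 0 ≤ W η)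
    (hW : ∀ η x y, η x = 1 → η y = 0 → W η * r y = W (η ∘ Equiv.swap x y) * r x)
    (f : Config (box L a) → ℝ) :
    ∑ x, ∑ y, moveForm W r f x y ≤
      (2 * (Λ / c)) ^ d * (Λ ^ 3 / c ^ 3 * L * L * (L : ℝ) ^ d) * (d *
        ∑ x : box L a, ∑ y : box L a,
          if Neighbour (x : Fin d → ℤ) y then moveForm W r f x y else 0) := by
  have hr : ∀ x, 0 < r x := fun x => hc.trans_le (hcr x)
  have hΛ : 0 < Λ := hc.trans_le hcΛ
  have hD := moveForm_nonneg hr hW0 f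
  have h1 : 1 ≤ Λ / c := (one_le_div hc).2 hcΛ
  have h := sum_pairs_le
    (D := fun u v : Fin d → Fin L => moveForm W r f (boxEquiv L a u) (boxEquiv L a v))
    (fun _ _ => hD _ _) (fun _ => moveForm_self _ _ _ _) (A := 2 * (Λ / c)) (by linarith)
    (fun _ _ _ => moveForm_quasi_triangle hc hcr hrΛ hcΛ hW0 hW f _ _ _)
    (B := Λ ^ 3 / c ^ 3 * L) (stepForm W r f)
    (fun x i t => moveForm_line_le hc hcr hrΛ hcΛ hW0 hW f x i t)
  have hlhs : ∑ u : Fin d → Fin L, ∑ v : Fin d → Fin L,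
      moveForm W r f (boxEquiv L a u) (boxEquiv L a v) = ∑ x, ∑ y, moveForm W r f x y := by
    rw [← Equiv.sum_comp (boxEquiv L a)]
    refine Finset.sum_congr rfl fun u _ => ?_
    exact Equiv.sum_comp (boxEquiv L a) _
  rw [hlhs] at h
  refine h.trans (mul_le_mul_of_nonneg_left ?_ (by positivity))
  -- Each direction is bounded by the full neighbour sum, which is where the factor $d$ comes from.
  have hi : ∀ i : Fin d, ∑ w, stepForm W r f i w ≤ ∑ x : box L a, ∑ y : box L a,
      if Neighbour (x : Fin d → ℤ) y then moveForm W r f x y else 0 := by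
    intro i
    rw [← Equiv.sum_comp (boxEquiv L a)]
    refine Finset.sum_le_sum fun w _ => ?_
    have h0 : ∀ y : box L a, 0 ≤ if Neighbour (boxEquiv L a w : Fin d → ℤ) y then
        moveForm W r f (boxEquiv L a w) y else 0 := by
      intro y; split_ifs <;> simp [hD]
    unfold stepForm
    split_ifs with hw
    · have := Finset.single_le_sum (fun y _ => h0 y)
        (Finset.mem_univ (boxEquiv L a (Function.update w i ⟨w i + 1, hw⟩)))
      rwa [if_pos (neighbour_boxEquiv_update a w i hw)] at this
    · exact Finset.sum_nonneg fun y _ => h0 y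
  refine (Finset.sum_le_sum fun i _ => hi i).trans ?_
  simp

end Weights

/-! ### Weights and the canonical measure -/

lemma exchange_eq_comp_swap {d : ℕ} {Λ : Finset (Fin d → ℤ)} (x y : Λ) (η : Config Λ) :
    exchange x y η = η ∘ Equiv.swap x y := by
  funext z
  simp only [exchange, Function.comp_apply, Equiv.swap_apply_def]
  split_ifs <;> rfl

lemma density_mem_Ioo {d : ℕ} (α : (Fin d → ℤ) → ℝ) (x : Fin d → ℤ) :
    0 < density α x ∧ 0 < 1 - density α x := by
  have := Real.exp_pos (α x)
  unfold density
  refine ⟨by positivity, ?_⟩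
  rw [sub_pos, div_lt_one (by positivity)]
  linarith

lemma weight_pos {d : ℕ} (α : (Fin d → ℤ) → ℝ) (Λ : Finset (Fin d → ℤ)) (η : Config Λ) :
    0 < weight α Λ η :=
  Finset.prod_pos fun x _ => mul_pos (pow_pos (density_mem_Ioo α x).1 _)
    (pow_pos (density_mem_Ioo α x).2 _)

/-- Gibbs form of the product weight, since $p_x/(1-p_x)=e^{\alpha_x}$; it makes detailed balance
with rates $e^{\alpha_x}$ visible. -/
lemma weight_eq {d : ℕ} (α : (Fin d → ℤ) → ℝ) (Λ : Finset (Fin d → ℤ)) (η : Config Λ) :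
    weight α Λ η =
      (∏ x : Λ, (1 - density α x)) * Real.exp (∑ x : Λ, α x * ((η x : ℕ) : ℝ)) := by
  rw [Real.exp_sum, ← Finset.prod_mul_distrib]
  refine Finset.prod_congr rfl fun x _ => ?_
  have := Real.exp_pos (α x)
  generalize η x = t
  fin_cases t
  · simp
  · simp only [density]
    simp
    field_simp
    ring

lemma weight_mul_exp {d : ℕ} (α : (Fin d → ℤ) → ℝ) (Λ : Finset (Fin d → ℤ)) (η : Config Λ)
    (x y : Λ) (hx : η x = 1) (hy : η y = 0) :
    weight α Λ η * Real.exp (α y) = weight α Λ (η ∘ Equiv.swap x y) * Real.exp (α x) := by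
  rw [weight_eq, weight_eq, mul_assoc, mul_assoc, ← Real.exp_add, ← Real.exp_add]
  congr 2
  have hxy : x ≠ y := by rintro rfl; rw [hx] at hy; exact absurd hy (by decide)
  have h : ∑ z : Λ, (α z * ((η z : ℕ) : ℝ) - α z * (((η ∘ Equiv.swap x y) z : ℕ) : ℝ)) =
      ∑ z : Λ, ((if z = x then α x else 0) - if z = y then α y else 0) := by
    refine Finset.sum_congr rfl fun z _ => ?_
    by_cases h1 : z = x
    · subst h1; simp [hx, hy, hxy]
    by_cases h2 : z = y
    · subst h2; simp [hx, hy, h1]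
    simp [Equiv.swap_apply_of_ne_of_ne h1 h2, h1, h2]
  simp only [Finset.sum_sub_distrib, Finset.sum_ite_eq', Finset.mem_univ, if_true] at h
  linarith

/-- The weight of a configuration, restricted to the configurations with `N` particles. -/
noncomputable def sectorWeight {d : ℕ} (α : (Fin d → ℤ) → ℝ) (Λ : Finset (Fin d → ℤ)) (N : ℕ)
    (η : Config Λ) : ℝ :=
  if particleNumber η = N then weight α Λ η else 0

lemma sectorWeight_nonneg {d : ℕ} (α : (Fin d → ℤ) → ℝ) (Λ : Finset (Fin d → ℤ)) (N : ℕ)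
    (η : Config Λ) : 0 ≤ sectorWeight α Λ N η := by
  unfold sectorWeight
  split_ifs
  exacts [(weight_pos α Λ η).le, le_rfl]

lemma sectorWeight_mul_exp {d : ℕ} (α : (Fin d → ℤ) → ℝ) (Λ : Finset (Fin d → ℤ)) (N : ℕ)
    (η : Config Λ) (x y : Λ) (hx : η x = 1) (hy : η y = 0) :
    sectorWeight α Λ N η * Real.exp (α y) =
      sectorWeight α Λ N (η ∘ Equiv.swap x y) * Real.exp (α x) := by
  have h : particleNumber (η ∘ Equiv.swap x y) = particleNumber η :=
    Equiv.sum_comp (Equiv.swap x y) fun z => (η z : ℕ)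
  unfold sectorWeight
  rw [h]
  split_ifs
  · exact weight_mul_exp α Λ η x y hx hy
  · simp

lemma sum_sector {d : ℕ} (α : (Fin d → ℤ) → ℝ) (Λ : Finset (Fin d → ℤ)) (N : ℕ)
    (F : Config Λ → ℝ) :
    ∑ η : Sector Λ N, weight α Λ η.1 * F η.1 = ∑ η, sectorWeight α Λ N η * F η := by
  rw [← Finset.sum_subtype (Finset.univ.filter fun η : Config Λ => particleNumber η = N)
    (fun η => by rw [Finset.mem_filter]; exact and_iff_right (Finset.mem_univ η))
    (fun η => weight α Λ η * F η), Finset.sum_filter]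
  refine Finset.sum_congr rfl fun η _ => ?_
  unfold sectorWeight
  split_ifs <;> simp

lemma inhomBernoulliMeasure_apply {d : ℕ} (α : (Fin d → ℤ) → ℝ) (Λ : Finset (Fin d → ℤ))
    (S : Set (Config Λ)) [DecidablePred (· ∈ S)] :
    inhomBernoulliMeasure α Λ S =
      ENNReal.ofReal (∑ η : Config Λ, if η ∈ S then weight α Λ η else 0) := by
  rw [ENNReal.ofReal_sum_of_nonneg fun η _ => by
    split_ifs; exacts [(weight_pos α Λ η).le, le_rfl]]
  unfold inhomBernoulliMeasure
  rw [Measure.finsetSum_apply]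
  refine Finset.sum_congr rfl fun η _ => ?_
  rw [Measure.smul_apply, Measure.dirac_apply' _ (Set.toFinite S).measurableSet]
  by_cases h : η ∈ S <;> simp [h]

lemma canonicalMeasure_real_singleton {d : ℕ} (α : (Fin d → ℤ) → ℝ) (Λ : Finset (Fin d → ℤ))
    (N : ℕ) (η : Config Λ) :
    (canonicalMeasure α Λ N).real {η} =
      sectorWeight α Λ N η / ∑ σ, sectorWeight α Λ N σ := by
  classical
  unfold canonicalMeasure Measure.real
  rw [cond_apply (Set.toFinite _).measurableSet, inhomBernoulliMeasure_apply,
    inhomBernoulliMeasure_apply, ENNReal.toReal_mul, ENNReal.toReal_inv,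
    ENNReal.toReal_ofReal, ENNReal.toReal_ofReal, div_eq_inv_mul]
  · congr 1
    rw [Finset.sum_eq_single η]
    · simp [sectorWeight]
    · intro σ _ h; simp [h]
    · simp
  · refine Finset.sum_nonneg fun σ _ => ?_
    split_ifs
    exacts [(weight_pos α Λ σ).le, le_rfl]
  · exact Finset.sum_nonneg fun σ _ => sectorWeight_nonneg α Λ N σ

lemma integral_canonicalMeasure {d : ℕ} (α : (Fin d → ℤ) → ℝ) (Λ : Finset (Fin d → ℤ))
    (N : ℕ) (F : Config Λ → ℝ) :
    ∫ η, F η ∂(canonicalMeasure α Λ N) =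
      (∑ η, sectorWeight α Λ N η * F η) / ∑ σ, sectorWeight α Λ N σ := by
  have : IsFiniteMeasure (inhomBernoulliMeasure α Λ) := by
    classical
    refine ⟨?_⟩
    rw [inhomBernoulliMeasure_apply]
    exact ENNReal.ofReal_lt_top
  have : IsFiniteMeasure (canonicalMeasure α Λ N) := by
    unfold canonicalMeasure; infer_instance
  rw [integral_fintype Integrable.of_finite, Finset.sum_div]
  refine Finset.sum_congr rfl fun η _ => ?_
  rw [canonicalMeasure_real_singleton, smul_eq_mul]
  ring

/-! ### Assembling the Poincaré inequality -/

/-- A jump term of the sector Dirichlet form in terms of `moveForm`. -/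
lemma sum_sector_jump_le {d : ℕ} {K : ℝ} {α : (Fin d → ℤ) → ℝ} (hα : ∀ x, |α x| ≤ K)
    (Λ : Finset (Fin d → ℤ)) (N : ℕ) (g : Config Λ → ℝ) (x y : Λ) :
    ∑ η : Sector Λ N, (if η.1 x = 1 ∧ η.1 y = 0 then
        weight α Λ η.1 * Real.exp (α y) * (g (η.swap x y).1 - g η.1) ^ 2 else 0) ≤
      Real.exp K ^ 2 * moveForm (sectorWeight α Λ N) (fun x => Real.exp (α x)) g x y := by
  set φ : Config Λ → ℝ := fun η =>
    if η x = 1 ∧ η y = 0 then Real.exp (α y) * (g (η ∘ Equiv.swap x y) - g η) ^ 2 else 0 with hφ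
  have e : ∑ η : Sector Λ N, (if η.1 x = 1 ∧ η.1 y = 0 then
      weight α Λ η.1 * Real.exp (α y) * (g (η.swap x y).1 - g η.1) ^ 2 else 0) =
      ∑ η : Sector Λ N, weight α Λ η.1 * φ η.1 := by
    refine Finset.sum_congr rfl fun η _ => ?_
    simp only [hφ, mul_ite, mul_zero, mul_assoc]
    rfl
  rw [e, sum_sector α Λ N φ]
  unfold moveForm
  rw [Finset.mul_sum]
  refine Finset.sum_le_sum fun η _ => ?_
  by_cases h : η x = 1 ∧ η y = 0
  · have hφη : φ η = Real.exp (α y) * (g (η ∘ Equiv.swap x y) - g η) ^ 2 := if_pos h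
    rw [if_pos h, hφη]
    have e1 : Real.exp (α y) ≤ Real.exp K ^ 2 / Real.exp (α x) := by
      rw [le_div_iff₀ (Real.exp_pos _), sq]
      exact mul_le_mul (Real.exp_le_exp.2 (abs_le.1 (hα y)).2)
        (Real.exp_le_exp.2 (abs_le.1 (hα x)).2) (Real.exp_pos _).le (Real.exp_pos _).le
    have e2 : 0 ≤ sectorWeight α Λ N η * (g (η ∘ Equiv.swap x y) - g η) ^ 2 :=
      mul_nonneg (sectorWeight_nonneg α Λ N η) (sq_nonneg _)
    have := mul_le_mul_of_nonneg_right e1 e2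
    calc _ = Real.exp (α y) *
          (sectorWeight α Λ N η * (g (η ∘ Equiv.swap x y) - g η) ^ 2) := by ring
      _ ≤ _ := this
      _ = _ := by ring
  · have hφη : φ η = 0 := if_neg h
    rw [if_neg h, hφη, mul_zero, mul_zero]

/-- The moves between nearest neighbours are controlled by the Kawasaki form. -/
lemma sum_neighbour_moveForm_le {d : ℕ} {K : ℝ} {α : (Fin d → ℤ) → ℝ} (hα : ∀ x, |α x| ≤ K)
    (Λ : Finset (Fin d → ℤ)) (N : ℕ) (g : Config Λ → ℝ) :
    ∑ x : Λ, ∑ y : Λ, (if Neighbour (x : Fin d → ℤ) y then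
        moveForm (sectorWeight α Λ N) (fun x => Real.exp (α x)) g x y else 0) ≤
      1 / Real.exp (-K) * ∑ η, sectorWeight α Λ N η * ∑ x : Λ, ∑ y : Λ,
        if Neighbour (x : Fin d → ℤ) y then (g (exchange x y η) - g η) ^ 2 else 0 := by
  have e : ∑ η, sectorWeight α Λ N η * ∑ x : Λ, ∑ y : Λ,
      (if Neighbour (x : Fin d → ℤ) y then (g (exchange x y η) - g η) ^ 2 else 0) =
      ∑ x : Λ, ∑ y : Λ, ∑ η, sectorWeight α Λ N η *
      if Neighbour (x : Fin d → ℤ) y then (g (exchange x y η) - g η) ^ 2 else 0 := by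
    simp only [Finset.mul_sum]
    rw [Finset.sum_comm]
    refine Finset.sum_congr rfl fun x _ => ?_
    rw [Finset.sum_comm]
  rw [e]
  simp only [Finset.mul_sum _ _ (1 / Real.exp (-K))]
  refine Finset.sum_le_sum fun x _ => Finset.sum_le_sum fun y _ => ?_
  by_cases hxy : Neighbour (x : Fin d → ℤ) y
  · simp only [if_pos hxy]
    unfold moveForm
    refine Finset.sum_le_sum fun η _ => ?_
    have h1 : 1 / Real.exp (α x) ≤ 1 / Real.exp (-K) :=
      one_div_le_one_div_of_le (Real.exp_pos _) (Real.exp_le_exp.2 (abs_le.1 (hα x)).1)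
    have h2 : 0 ≤ sectorWeight α Λ N η * (g (η ∘ Equiv.swap x y) - g η) ^ 2 :=
      mul_nonneg (sectorWeight_nonneg α Λ N η) (sq_nonneg _)
    rw [exchange_eq_comp_swap]
    split_ifs
    · calc _ = 1 / Real.exp (α x) *
            (sectorWeight α Λ N η * (g (η ∘ Equiv.swap x y) - g η) ^ 2) := by ring
        _ ≤ _ := mul_le_mul_of_nonneg_right h1 h2
    · exact mul_nonneg (one_div_nonneg.2 (Real.exp_pos _).le) h2
  · simp [hxy]

/-- Poincaré inequality in an inhomogeneous box, in terms of weights. -/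
lemma box_poincare {d : ℕ} {K : ℝ} {α : (Fin d → ℤ) → ℝ} (hα : ∀ x, |α x| ≤ K) (L : ℕ)
    (a : Fin d → ℤ) (N : ℕ) (g : Config (box L a) → ℝ)
    (hg : ∑ η, sectorWeight α (box L a) N η * g η = 0) (hL : 0 < (L : ℝ) ^ d) :
    ∑ η, sectorWeight α (box L a) N η * g η ^ 2 ≤
      1 / 2 * Real.exp K ^ 2 / Real.exp (-K) * ((2 * (Real.exp K / Real.exp (-K))) ^ d *
        (Real.exp K ^ 3 / Real.exp (-K) ^ 3) * (d / Real.exp (-K))) * (L : ℝ) ^ 2 *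
      ∑ η, sectorWeight α (box L a) N η * ∑ x : box L a, ∑ y : box L a,
        if Neighbour (x : Fin d → ℤ) y then (g (exchange x y η) - g η) ^ 2 else 0 := by
  set c := Real.exp (-K) with hcdef
  set Λ := Real.exp K with hΛdef
  set r : box L a → ℝ := fun x => Real.exp (α x) with hrdef
  set W := sectorWeight α (box L a) N with hWdef
  have hc : 0 < c := Real.exp_pos _
  have hΛ : 0 < Λ := Real.exp_pos _
  have hr : ∀ x, 0 < r x := fun x => Real.exp_pos _
  have hcr : ∀ x, c ≤ r x := fun x => Real.exp_le_exp.2 (abs_le.1 (hα x)).1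
  have hrΛ : ∀ x, r x ≤ Λ := fun x => Real.exp_le_exp.2 (abs_le.1 (hα x)).2
  have hcΛ : c ≤ Λ := by
    have := (abs_nonneg _).trans (hα 0)
    exact Real.exp_le_exp.2 (by linarith)
  have hW0 : ∀ η, 0 ≤ W η := sectorWeight_nonneg α (box L a) N
  have hW : ∀ η x y, η x = 1 → η y = 0 → W η * r y = W (η ∘ Equiv.swap x y) * r x :=
    sectorWeight_mul_exp α (box L a) N
  have hcard : (Fintype.card (box L a) : ℝ) = (L : ℝ) ^ d := by
    rw [← Fintype.card_congr (boxEquiv L a)]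
    simp
  have hgap := sector_poincare N r hc hcr (weight α (box L a)) (weight_pos α _)
    (weight_mul_exp α (box L a)) (fun η => g η.1) (by rw [sum_sector α _ N g]; exact hg)
  rw [hcard, sum_sector α _ N fun η => g η ^ 2] at hgap
  have hpairs : ∑ x, ∑ y, ∑ η : Sector (box L a) N, (if η.1 x = 1 ∧ η.1 y = 0 then
        weight α (box L a) η.1 * r y * (g (η.swap x y).1 - g η.1) ^ 2 else 0) ≤
      Λ ^ 2 * ∑ x, ∑ y, moveForm W r g x y := by
    simp only [Finset.mul_sum]
    exact Finset.sum_le_sum fun x _ => Finset.sum_le_sum fun y _ =>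
      sum_sector_jump_le hα (box L a) N g x y
  have hkaw := sum_neighbour_moveForm_le hα (box L a) N g
  have hmain := sum_moveForm_le hc hcr hrΛ hcΛ hW0 hW g
  set Q := ∑ η, W η * ∑ x : box L a, ∑ y : box L a,
        if Neighbour (x : Fin d → ℤ) y then (g (exchange x y η) - g η) ^ 2 else 0
  have h1 : c * (L : ℝ) ^ d * ∑ η, W η * g η ^ 2 ≤
      1 / 2 * (Λ ^ 2 * ((2 * (Λ / c)) ^ d * (Λ ^ 3 / c ^ 3 * L * L * (L : ℝ) ^ d) *
        (d * (1 / c * Q)))) := by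
    refine hgap.trans ?_
    gcongr
    refine hpairs.trans ?_
    gcongr
    refine hmain.trans ?_
    gcongr
  -- Division by the gap $cL^d$ cancels the volume and leaves $L\cdot L$.
  rw [← le_div_iff₀' (by positivity)] at h1
  refine h1.trans (le_of_eq ?_)
  field_simp

end InhomBernoulli

theorem theorem3 (d : ℕ) (K : ℝ) (hK : 0 < K) :
    ∃ C : ℝ, ∀ α : (Fin d → ℤ) → ℝ, (∀ x, |α x| ≤ K) →
      ∀ (L : ℕ) (a : Fin d → ℤ) (N : ℕ), N ≤ L ^ d →
        ∀ f : InhomBernoulli.Config (InhomBernoulli.box L a) → ℝ,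
          ProbabilityTheory.variance f
              (InhomBernoulli.canonicalMeasure α (InhomBernoulli.box L a) N) ≤
            C * (L : ℝ) ^ 2 *
              InhomBernoulli.kawasakiForm α (InhomBernoulli.box L a) N f := by
  refine ⟨1 / 2 * Real.exp K ^ 2 / Real.exp (-K) * ((2 * (Real.exp K / Real.exp (-K))) ^ d *
        (Real.exp K ^ 3 / Real.exp (-K) ^ 3) * (d / Real.exp (-K))), ?_⟩
  intro α hα L a N _ f
  rw [ProbabilityTheory.variance_eq_integral Measurable.of_discrete.aemeasurable,
    InhomBernoulli.kawasakiForm, InhomBernoulli.integral_canonicalMeasure,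
    InhomBernoulli.integral_canonicalMeasure, InhomBernoulli.integral_canonicalMeasure]
  set W := InhomBernoulli.sectorWeight α (InhomBernoulli.box L a) N with hW
  have hZ0 : 0 ≤ ∑ η, W η :=
    Finset.sum_nonneg fun η _ => InhomBernoulli.sectorWeight_nonneg α _ N η
  -- If no configuration carries weight, all integrals are quotients by zero and both sides vanish.
  rcases hZ0.eq_or_lt with hZ | hZ
  · simp [← hZ]
  set m := (∑ η, W η * f η) / ∑ η, W η with hm
  have hmean : ∑ η, W η * (f η - m) = 0 := by
    simp only [mul_sub, Finset.sum_sub_distrib, ← Finset.sum_mul]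
    rw [hm, mul_div_cancel₀ _ hZ.ne', sub_self]
  rw [← mul_div_assoc]
  refine div_le_div_of_nonneg_right ?_ hZ.le
  -- The gap bound is divided by $L^d$, so the empty box is treated apart: it has a single
  -- configuration and zero variance.
  rcases (by positivity : 0 ≤ (L : ℝ) ^ d).eq_or_lt with hL | hL
  · have hempty : IsEmpty (InhomBernoulli.box L a) := by
      rw [← Fintype.card_eq_zero_iff, ← Fintype.card_congr (InhomBernoulli.boxEquiv L a)]
      simpa using (by exact_mod_cast hL.symm : L ^ d = 0)
    let η₀ : InhomBernoulli.Config (InhomBernoulli.box L a) := fun _ => 0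
    rw [Fintype.sum_subsingleton _ η₀] at hmean hZ
    have h0 : f η₀ - m = 0 := (mul_eq_zero.1 hmean).resolve_left hZ.ne'
    rw [Fintype.sum_subsingleton _ η₀, h0]
    simp
  · have h := InhomBernoulli.box_poincare hα L a N (fun η => f η - m) hmean hL
    simpa using h
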